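/- **Setting.** A metric measure space $(X,d,m)$ is a complete separable metric space $(X,d)$ with a Borel measure $m$ such that $0<m(B_r(x))<\infty$ for all $x\in X$ and $r>0$. $\mathcal P_2(X)$ is the set of Borel probability measures on $X$ with finite second moment, and $$W_2(\mu,\nu)=\inf_\pi\Big(\int_{X\times X} d(x,x')^2\,d\pi(x,x')\Big)^{1/2}\in[0,\infty]$$ is the Wasserstein distance between Borel probability measures, the infimum being over all transport plans $\pi$ between $\mu$ and $\nu$. For a probability measure $\mu=\rho m$ such that the positive part of $\rho\log\rho$ is $m$-integrable, $\mathrm{Ent}_m(\mu)=\int_X\rho\log\rho\,dm\in[-\infty,\infty)$; for every other probability measure $\mu$, $\mathrm{Ent}_m(\mu)=+\infty$. *$\mathrm{CD}(K,\infty)$*, for $K\in\mathbb R$: for all $\mu_0,\mu_1\in\mathcal P_2(X)$ with $\mathrm{Ent}_m(\mu_i)<\infty$ there is a curve $(\mu_t)_{t\in[0,1]}$ in $\mathcal P_2(X)$ joining $\mu_0$ and $\mu_1$ such that $W_2(\mu_s,\mu_t)=|s-t|\,W_2(\mu_0,\mu_1)$ for all $s,t\in[0,1]$, and $$\mathrm{Ent}_m(\mu_t)\le(1-t)\,\mathrm{Ent}_m(\mu_0)+t\,\mathrm{Ent}_m(\mu_1)-\frac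 K2\,t(1-t)\,W_2(\mu_0,\mu_1)^2\qquad\text{for all } t\in[0,1].$$ *(VG)*: there are $\bar x\in X$ and $C>0$ with $\int_X e^{-C^2d(x,\bar x)^2}\,dm(x)<\infty$. *Metric foliation*: a covering $\mathcal F$ of $X$ by pairwise disjoint closed sets (the leaves) such that $d(F,F')=d(x,F')$ for all $F,F'\in\mathcal F$ and $x\in F$, where $d(A,B)=\inf_{a\in A,\,b\in B}d(a,b)$. The quotient space $X^*$ is the set of equivalence classes for the relation of lying in a common leaf, $p:X\to X^*$ is the quotient map, $d^*(y,y')=d(p^{-1}(y),p^{-1}(y'))$ is the quotient metric, and $m^*=p_*m$. *Metric measure foliation*: a metric foliation such that $m^*$ is finite on balls and there is a Borel set $\Omega\subset X^*$ with $m^*(X^*\setminus\Omega)=0$ and $W_2(\mu_y,\mu_{y'})=d^*(y,y')$ for all $y,y'\in\Omega$. Here $\{\mu_y\}_{y\in X^*}$ is the disintegration of $m$ for $p$: a family of Borel probability measures on $X$, depending measurably on $y$, with $\mu_y(X\setminus p^{-1}(y))=0$ for $m^*$-a.e. $y$ and $\int_X f\,dm=\int_{X^*}\int_{p^{-1}(y)}f\,d\mu_y\,dm^*(y)$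 for every Borel function $f:X\to[0,\infty]$. The leaves may be unbounded. **Theorem.** Let $(X,d,m)$ be a metric measure space with a metric measure foliation and let $K\in\mathbb R$. If $(X,d,m)$ satisfies $\mathrm{CD}(K,\infty)$ and the quotient $(X^*,d^*,m^*)$ satisfies (VG), then $(X^*,d^*,m^*)$ satisfies $\mathrm{CD}(K,\infty)$. -/

import Mathlib

open MeasureTheory ProbabilityTheory Set TopologicalSpace
open scoped ENNReal

/-! ### Metric measure spaces -/

/-- `m` is finite on every ball; this is what "locally finite" means here. -/
def FiniteOnBalls {X : Type*} [MetricSpace X] [MeasurableSpace X] (m : Measure X) : Prop :=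
  ∀ (x : X) (r : ℝ), m (Metric.ball x r) < ∞

/-- `(X, d, m)` is a metric measure space: `(X, d)` is complete and separable, the σ-algebra of `X`
is the Borel σ-algebra, and every ball of positive radius has positive and finite measure. -/
structure IsMMSpace (X : Type*) [MetricSpace X] [MeasurableSpace X] (m : Measure X) : Prop where
  complete : CompleteSpace X
  separable : SeparableSpace X
  borel : BorelSpace X
  ball_pos : ∀ (x : X) (r : ℝ), 0 < r → 0 < m (Metric.ball x r)
  finiteOnBalls : FiniteOnBalls m

/-! ### The Wasserstein distance and the relative entropy -/

section Transport

variable {X : Type*} [MetricSpace X] [MeasurableSpace X]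

/-- The transport plans between `μ` and `ν`. -/
def transportPlans (μ ν : Measure X) : Set (Measure (X × X)) :=
  {π | π.map Prod.fst = μ ∧ π.map Prod.snd = ν}

/-- The (extended) `L²`-Wasserstein distance between two Borel probability measures. -/
noncomputable def W2 (μ ν : Measure X) : ℝ≥0∞ :=
  ⨅ π ∈ transportPlans μ ν, (∫⁻ z, edist z.1 z.2 ^ 2 ∂π) ^ (1 / 2 : ℝ)

variable (X) in
/-- The Borel probability measures on `X` with finite second moment. -/
def P2 : Set (Measure X) :=
  {μ | IsProbabilityMeasure μ ∧ ∃ x₀ : X, ∫⁻ x, edist x x₀ ^ 2 ∂μ < ∞}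

/-- `μ`, restricted to `[0, 1]`, is a minimal geodesic in `(P2 X, W2)`. -/
def IsW2Geodesic (μ : ℝ → Measure X) : Prop :=
  (∀ t ∈ Icc (0 : ℝ) 1, μ t ∈ P2 X) ∧
    ∀ s ∈ Icc (0 : ℝ) 1, ∀ t ∈ Icc (0 : ℝ) 1,
      W2 (μ s) (μ t) = ENNReal.ofReal |s - t| * W2 (μ 0) (μ 1)

/-- The function `ρ log ρ`, where `ρ` is the density of `μ` with respect to `m`. -/
noncomputable def entropyDensity {X : Type*} [MeasurableSpace X] (m μ : Measure X) (x : X) : ℝ :=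
  (μ.rnDeriv m x).toReal * Real.log (μ.rnDeriv m x).toReal

open Classical in
/-- The relative entropy of the probability measure `μ` with respect to `m`, with values in
`[-∞, +∞]`. If `μ = ρ m` and the positive part of `ρ log ρ` is `m`-integrable, it is
`∫ ρ log ρ dm ∈ [-∞, +∞)` (positive part minus negative part, the latter may be infinite);
in all other cases it is `+∞`. -/
noncomputable def Ent {X : Type*} [MeasurableSpace X] (m μ : Measure X) : EReal :=
  if μ ≪ m ∧ ∫⁻ x, ENNReal.ofReal (entropyDensity m μ x) ∂m < ∞ then
    ((∫⁻ x, ENNReal.ofReal (entropyDensity m μ x) ∂m : ℝ≥0∞) : EReal)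
      - ((∫⁻ x, ENNReal.ofReal (-entropyDensity m μ x) ∂m : ℝ≥0∞) : EReal)
  else ⊤

/-- The curvature-dimension condition `CD(K, ∞)` for `(X, d, m)`. -/
def CDInfty (K : ℝ) (m : Measure X) : Prop :=
  ∀ μ₀ ∈ P2 X, ∀ μ₁ ∈ P2 X, Ent m μ₀ < ⊤ → Ent m μ₁ < ⊤ →
    ∃ μ : ℝ → Measure X, IsW2Geodesic μ ∧ μ 0 = μ₀ ∧ μ 1 = μ₁ ∧
      ∀ t ∈ Icc (0 : ℝ) 1,
        Ent m (μ t) ≤ ((1 - t : ℝ) : EReal) * Ent m μ₀ + (t : EReal) * Ent m μ₁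
          - ((K / 2 * t * (1 - t) * (W2 μ₀ μ₁).toReal ^ 2 : ℝ) : EReal)

/-- The volume growth condition (VG) for `(X, d, m)`. -/
def VolumeGrowth (m : Measure X) : Prop :=
  ∃ (x₀ : X) (C : ℝ), 0 < C ∧ ∫⁻ x, ENNReal.ofReal (Real.exp (-(C ^ 2 * dist x x₀ ^ 2))) ∂m < ∞

end Transport

/-! ### Metric foliations and the space of leaves -/

/-- The distance `inf {d(a, b) | a ∈ A, b ∈ B}` between two subsets. -/
noncomputable def setEDist {X : Type*} [MetricSpace X] (A B : Set X) : ℝ≥0∞ :=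
  ⨅ a ∈ A, ⨅ b ∈ B, edist a b

/-- A metric foliation: a covering of `X` by pairwise disjoint closed subsets, such that
`d(L, L') = d(x, L')` for all leaves `L`, `L'` and all `x ∈ L`. -/
structure MetricFoliation (X : Type*) [MetricSpace X] where
  leaves : Set (Set X)
  isClosed : ∀ L ∈ leaves, IsClosed L
  disjoint : ∀ L ∈ leaves, ∀ L' ∈ leaves, L ≠ L' → Disjoint L L'
  cover : ⋃₀ leaves = univ
  equidistant : ∀ L ∈ leaves, ∀ L' ∈ leaves, ∀ x ∈ L, setEDist L L' = Metric.infEDist x L'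

namespace MetricFoliation

variable {X : Type*} [MetricSpace X]

theorem eq_of_mem (F : MetricFoliation X) {L L' : Set X} (hL : L ∈ F.leaves) (hL' : L' ∈ F.leaves)
    {x : X} (hx : x ∈ L) (hx' : x ∈ L') : L = L' := by
  by_contra h
  exact Set.disjoint_left.1 (F.disjoint L hL L' hL' h) hx hx'

/-- The equivalence relation of lying in a common leaf. -/
def setoid (F : MetricFoliation X) : Setoid X where
  r x x' := ∃ L ∈ F.leaves, x ∈ L ∧ x' ∈ L
  iseqv :=
    { refl := fun x => by
        obtain ⟨L, hL, hx⟩ := mem_sUnion.1 (F.cover ▸ mem_univ x)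
        exact ⟨L, hL, hx, hx⟩
      symm := fun ⟨L, hL, h, h'⟩ => ⟨L, hL, h', h⟩
      trans := fun ⟨L, hL, h, h'⟩ ⟨L', hL', k, k'⟩ =>
        ⟨L, hL, h, by rwa [F.eq_of_mem hL hL' h' k]⟩ }

/-- The quotient space `X* = X / ∼`. -/
def LeafSpace (F : MetricFoliation X) : Type _ := Quotient F.setoid

/-- The quotient map `p : X → X*`. -/
def proj (F : MetricFoliation X) (x : X) : F.LeafSpace := Quotient.mk F.setoid x

theorem proj_surjective (F : MetricFoliation X) : Function.Surjective F.proj :=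
  fun y => Quotient.exists_rep y

theorem preimage_proj (F : MetricFoliation X) {L : Set X} (hL : L ∈ F.leaves) {x : X}
    (hx : x ∈ L) : F.proj ⁻¹' {F.proj x} = L := by
  ext x'
  constructor
  · intro h
    obtain ⟨L', hL', h1, h2⟩ := Quotient.exact (s := F.setoid) h
    rwa [F.eq_of_mem hL hL' hx h2]
  · intro h
    exact Quotient.sound (s := F.setoid) ⟨L, hL, h, hx⟩

theorem preimage_mem (F : MetricFoliation X) (y : F.LeafSpace) : F.proj ⁻¹' {y} ∈ F.leaves := by
  obtain ⟨x, rfl⟩ := F.proj_surjective y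
  obtain ⟨L, hL, hx⟩ := mem_sUnion.1 (F.cover ▸ mem_univ x)
  rwa [F.preimage_proj hL hx]

theorem setEDist_eq (F : MetricFoliation X) (x : X) (y : F.LeafSpace) :
    setEDist (F.proj ⁻¹' {F.proj x}) (F.proj ⁻¹' {y}) = Metric.infEDist x (F.proj ⁻¹' {y}) :=
  F.equidistant _ (F.preimage_mem _) _ (F.preimage_mem _) x rfl

/-- The distance `d*(y, y') = d(p⁻¹(y), p⁻¹(y'))` on `X*`. -/
noncomputable abbrev emetric (F : MetricFoliation X) : EMetricSpace F.LeafSpace where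
  edist y y' := setEDist (F.proj ⁻¹' {y}) (F.proj ⁻¹' {y'})
  edist_self y := by
    obtain ⟨x, rfl⟩ := F.proj_surjective y
    rw [setEDist_eq]
    exact Metric.infEDist_zero_of_mem rfl
  edist_comm y y' := by
    unfold setEDist
    rw [iInf₂_comm]
    simp_rw [edist_comm]
  edist_triangle y y' y'' := by
    obtain ⟨x, rfl⟩ := F.proj_surjective y
    rw [setEDist_eq, setEDist_eq]
    refine ENNReal.le_of_forall_pos_le_add fun ε hε hfin => ?_
    have h1 : Metric.infEDist x (F.proj ⁻¹' {y'}) < Metric.infEDist x (F.proj ⁻¹' {y'}) + ε :=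
      ENNReal.lt_add_right (ne_top_of_le_ne_top hfin.ne le_self_add) (by simpa using hε.ne')
    obtain ⟨x', hx', hlt⟩ := Metric.infEDist_lt_iff.1 h1
    have hx'' : F.proj x' = y' := hx'
    subst hx''
    rw [setEDist_eq]
    calc Metric.infEDist x (F.proj ⁻¹' {y''})
        ≤ edist x x' + Metric.infEDist x' (F.proj ⁻¹' {y''}) :=
          Metric.infEDist_le_edist_add_infEDist
      _ ≤ (Metric.infEDist x (F.proj ⁻¹' {F.proj x'}) + ε)
            + Metric.infEDist x' (F.proj ⁻¹' {y''}) := by gcongr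
      _ = _ := by ring
  eq_of_edist_eq_zero {y y'} h := by
    obtain ⟨x, rfl⟩ := F.proj_surjective y
    change setEDist _ _ = 0 at h
    rw [setEDist_eq] at h
    exact (Metric.mem_iff_infEDist_zero_of_closed (F.isClosed _ (F.preimage_mem y'))).2 h

noncomputable instance (F : MetricFoliation X) : MetricSpace F.LeafSpace :=
  letI := F.emetric
  EMetricSpace.toMetricSpace fun y y' => by
    obtain ⟨x, rfl⟩ := F.proj_surjective y
    change setEDist _ _ ≠ ∞
    rw [setEDist_eq]
    exact Metric.infEDist_ne_top (F.proj_surjective y')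

noncomputable instance (F : MetricFoliation X) : MeasurableSpace F.LeafSpace := borel _

instance (F : MetricFoliation X) : BorelSpace F.LeafSpace := ⟨rfl⟩

theorem edist_eq (F : MetricFoliation X) (y y' : F.LeafSpace) :
    edist y y' = setEDist (F.proj ⁻¹' {y}) (F.proj ⁻¹' {y'}) := rfl

theorem dist_eq (F : MetricFoliation X) (y y' : F.LeafSpace) :
    dist y y' = (setEDist (F.proj ⁻¹' {y}) (F.proj ⁻¹' {y'})).toReal := rfl

/-- The quotient map is a submetry. -/
theorem image_ball (F : MetricFoliation X) (x : X) (r : ℝ) :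
    F.proj '' Metric.ball x r = Metric.ball (F.proj x) r := by
  ext y
  have key : y ∈ Metric.ball (F.proj x) r
      ↔ Metric.infEDist x (F.proj ⁻¹' {y}) < ENNReal.ofReal r := by
    rw [← Metric.eball_ofReal, Metric.mem_eball, edist_comm, edist_eq, setEDist_eq]
  rw [key, Metric.infEDist_lt_iff]
  constructor
  · rintro ⟨x', hx', rfl⟩
    refine ⟨x', rfl, ?_⟩
    rwa [← Metric.eball_ofReal, Metric.mem_eball, edist_comm] at hx'
  · rintro ⟨x', hx', h⟩
    refine ⟨x', ?_, hx'⟩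
    rwa [← Metric.eball_ofReal, Metric.mem_eball, edist_comm]

theorem lipschitzWith_proj (F : MetricFoliation X) : LipschitzWith 1 F.proj := by
  intro x x'
  rw [edist_eq, setEDist_eq, ENNReal.coe_one, one_mul]
  exact Metric.infEDist_le_edist_of_mem rfl

theorem continuous_proj (F : MetricFoliation X) : Continuous F.proj :=
  F.lipschitzWith_proj.continuous

theorem exists_lift (F : MetricFoliation X) (x : X) (y : F.LeafSpace) {r : ℝ}
    (h : dist (F.proj x) y < r) : ∃ x', F.proj x' = y ∧ dist x x' < r := by
  have hy : y ∈ F.proj '' Metric.ball x r := by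
    rw [image_ball, Metric.mem_ball, dist_comm]; exact h
  obtain ⟨x', hx', rfl⟩ := hy
  exact ⟨x', rfl, by rwa [dist_comm]⟩

instance (F : MetricFoliation X) [SeparableSpace X] : SeparableSpace F.LeafSpace :=
  F.proj_surjective.denseRange.separableSpace F.continuous_proj

instance (F : MetricFoliation X) [CompleteSpace X] : CompleteSpace F.LeafSpace := by
  refine Metric.complete_of_convergent_controlled_sequences (fun n => (1 / 2 : ℝ) ^ n)
    (fun n => by positivity) fun u hu => ?_
  obtain ⟨x₀, hx₀⟩ := F.proj_surjective (u 0)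
  have step : ∀ n (x : {x : X // F.proj x = u n}),
      ∃ x' : {x : X // F.proj x = u (n + 1)}, dist x.1 x'.1 < (1 / 2 : ℝ) ^ n := by
    rintro n ⟨x, hx⟩
    obtain ⟨x', h1, h2⟩ := F.exists_lift x (u (n + 1))
      (by rw [hx]; exact hu n n (n + 1) le_rfl (Nat.le_succ n))
    exact ⟨⟨x', h1⟩, h2⟩
  choose f hf using step
  let z : ∀ n, {x : X // F.proj x = u n} := fun n => Nat.rec ⟨x₀, hx₀⟩ (fun k x => f k x) n
  have hz : ∀ n, dist (z n).1 (z (n + 1)).1 ≤ 1 * (1 / 2 : ℝ) ^ n := fun n => by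
    rw [one_mul]; exact (hf n (z n)).le
  obtain ⟨a, ha⟩ := cauchySeq_tendsto_of_complete
    (cauchySeq_of_le_geometric (1 / 2 : ℝ) 1 (by norm_num) hz)
  refine ⟨F.proj a, ?_⟩
  have := (F.continuous_proj.tendsto a).comp ha
  exact this.congr fun n => (z n).2

variable [MeasurableSpace X]

/-- The quotient measure `m* = p_* m`. -/
noncomputable def quotientMeasure (F : MetricFoliation X) (m : Measure X) :
    Measure F.LeafSpace :=
  m.map F.proj

/-- `κ`, viewed as the family `(κ y)` of probability measures on `X` depending measurably on
`y ∈ X*`, is a disintegration of `m` for the quotient map `p`. -/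
structure IsDisintegration (F : MetricFoliation X) (m : Measure X) (κ : Kernel F.LeafSpace X) :
    Prop where
  isProbabilityMeasure : ∀ y, IsProbabilityMeasure (κ y)
  concentrated : ∀ᵐ y ∂F.quotientMeasure m, κ y (F.proj ⁻¹' {y})ᶜ = 0
  lintegral_eq : ∀ f : X → ℝ≥0∞, Measurable f →
    ∫⁻ x, f x ∂m = ∫⁻ y, ∫⁻ x in F.proj ⁻¹' {y}, f x ∂κ y ∂F.quotientMeasure m

/-- The metric foliation is a metric measure foliation of `(X, d, m)`: the quotient measure is
finite on balls and the disintegration `(κ y)` of `m` for `p` satisfies `W2 (κ y) (κ y') = d*(y, y')`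
for all `y, y'` outside a null set. No boundedness of the leaves is required. -/
def IsMetricMeasureFoliation (F : MetricFoliation X) (m : Measure X) : Prop :=
  FiniteOnBalls (F.quotientMeasure m) ∧
    ∃ κ : Kernel F.LeafSpace X, F.IsDisintegration m κ ∧
      ∃ Ω : Set F.LeafSpace, MeasurableSet Ω ∧ F.quotientMeasure m Ωᶜ = 0 ∧
        ∀ y ∈ Ω, ∀ y' ∈ Ω, W2 (κ y) (κ y') = edist y y'

/-- The quotient of a metric measure space by a metric measure foliation is again a metric measure
space. -/
theorem isMMSpace_leafSpace {F : MetricFoliation X} {m : Measure X} (hX : IsMMSpace X m)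
    (hF : F.IsMetricMeasureFoliation m) : IsMMSpace F.LeafSpace (F.quotientMeasure m) := by
  have := hX.complete
  have := hX.separable
  have := hX.borel
  refine ⟨inferInstance, inferInstance, inferInstance, fun y r hr => ?_, hF.1⟩
  obtain ⟨x, rfl⟩ := F.proj_surjective y
  rw [quotientMeasure, Measure.map_apply F.continuous_proj.measurable measurableSet_ball]
  refine (hX.ball_pos x r hr).trans_le (measure_mono ?_)
  rw [← image_subset_iff, image_ball]

end MetricFoliation

open Filter Topology
open scoped NNReal

set_option linter.unusedSectionVars false

/-! ### Transport plans and the Wasserstein distance -/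

section Wasserstein

variable {X : Type*} [MetricSpace X] [MeasurableSpace X]

/-! The idea is to lift the end points to `X`, apply `CD(K, ∞)` there, and project back. For `ν = ρ
m*`, the lift `κ ∘ₘ ν` has density `ρ ∘ p` (`bind_eq_withDensity`) and projects back to `ν`
(`map_proj_bind`). Since the disintegration is isometric for `W2` off a null set, mixing optimal
plans between the `κ y` along an optimal plan of `ν₀`, `ν₁` couples the lifts at cost at most `W2 ν₀
ν₁ ^ 2` (`exists_plan_bind_le`). In the other direction, `p` is `1`-Lipschitz, so projecting does
not increase `W2` (`W2_map_le`).

The leaves may be unbounded, so a lift can have infinite second moment and `CD(K, ∞)` need not apply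
to it. The lifted plan is therefore restricted to large bounded sets and normalised
(`exists_truncation`). Its marginals lie in `P2 X`, their entropies are bounded by quantities
tending to those of `ν₀`, `ν₁` (`Ent_le_of_le_smul_withDensity`), and their squared distance is at
most `c n * W2 ν₀ ν₁ ^ 2` with `c n → 1`. The geodesics that `CD(K, ∞)` provides project to curves
in the quotient whose end points are only approximately the prescribed ones, and a limit has to be
taken.

Entropy is carried through in its dual form. With `h = -C² d(·, o)²` and `b` bounded, the functional
`∫ (b + h) dν + 1 - ∫ exp (b + h) dm*` bounds the entropy from below, and (VG) makes the exponential
integrable. Evaluating the inequality on `X` at `(b + h) ∘ p` transfers the bound to the quotient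
(`integral_add_one_sub_le_of_Ent_le`), and bounded continuous `b` suffice to recover the entropy
(`Ent_le_of_boundedContinuous`). The functional bounds also give tightness
(`isTightMeasureSet_of_exp_bound`).

The delicate term in the limit is `∫ h dν`: second moments are only lower semicontinuous under weak
convergence, which is the wrong direction. They do not escape to infinity here because the curves
are asymptotically minimal and their end points are dominated by `2 ν₀` and `2 ν₁`: tails of an
almost intermediate point are controlled by tails of the ends plus the defect from minimality
(`lintegral_tail_le`). All of this is assembled in `exists_isW2Geodesic_of_approx`. -/

/-- The quadratic cost of a transport plan. -/
noncomputable def transportCost (π : Measure (X × X)) : ℝ≥0∞ :=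
  ∫⁻ z, edist z.1 z.2 ^ 2 ∂π

theorem ENNReal.rpow_half_sq (a : ℝ≥0∞) : (a ^ (1 / 2 : ℝ)) ^ 2 = a := by
  rw [← ENNReal.rpow_natCast, ← ENNReal.rpow_mul]; norm_num

theorem W2_sq_le {μ ν : Measure X} {π : Measure (X × X)} (hπ : π ∈ transportPlans μ ν) :
    W2 μ ν ^ 2 ≤ transportCost π := by
  have h : W2 μ ν ≤ transportCost π ^ (1 / 2 : ℝ) := iInf₂_le π hπ
  calc W2 μ ν ^ 2 ≤ (transportCost π ^ (1 / 2 : ℝ)) ^ 2 := by gcongr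
    _ = _ := ENNReal.rpow_half_sq _

theorem le_W2_sq {μ ν : Measure X} {c : ℝ≥0∞}
    (h : ∀ π ∈ transportPlans μ ν, c ≤ transportCost π) : c ≤ W2 μ ν ^ 2 := by
  have h' : c ^ (1 / 2 : ℝ) ≤ W2 μ ν :=
    le_iInf₂ fun π hπ => ENNReal.rpow_le_rpow (h π hπ) (by norm_num)
  calc c = (c ^ (1 / 2 : ℝ)) ^ 2 := (ENNReal.rpow_half_sq _).symm
    _ ≤ _ := by gcongr

theorem exists_transportCost_lt {μ ν : Measure X} {c : ℝ≥0∞} (h : W2 μ ν ^ 2 < c) :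
    ∃ π ∈ transportPlans μ ν, transportCost π < c := by
  by_contra! H
  exact absurd (le_W2_sq H) (not_le.2 h)

theorem transportPlans_swap {μ ν : Measure X} {π : Measure (X × X)}
    (hπ : π ∈ transportPlans μ ν) : π.map Prod.swap ∈ transportPlans ν μ := by
  constructor
  · rw [Measure.map_map measurable_fst measurable_swap]; exact hπ.2
  · rw [Measure.map_map measurable_snd measurable_swap]; exact hπ.1

theorem isProbabilityMeasure_of_mem_transportPlans {μ ν : Measure X} [IsProbabilityMeasure μ]
    {π : Measure (X × X)} (hπ : π ∈ transportPlans μ ν) : IsProbabilityMeasure π := by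
  have : IsProbabilityMeasure (π.map Prod.fst) := by rw [hπ.1]; infer_instance
  exact Measure.isProbabilityMeasure_of_map Prod.fst

theorem prod_mem_transportPlans (μ ν : Measure X) [IsProbabilityMeasure μ]
    [IsProbabilityMeasure ν] : μ.prod ν ∈ transportPlans μ ν :=
  ⟨by simp, by simp⟩

theorem lintegral_comp_fst {μ ν : Measure X} {π : Measure (X × X)}
    (hπ : π ∈ transportPlans μ ν) {f : X → ℝ≥0∞} (hf : Measurable f) :
    ∫⁻ z, f z.1 ∂π = ∫⁻ x, f x ∂μ := by
  rw [← hπ.1, lintegral_map hf measurable_fst]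

theorem lintegral_comp_snd {μ ν : Measure X} {π : Measure (X × X)}
    (hπ : π ∈ transportPlans μ ν) {f : X → ℝ≥0∞} (hf : Measurable f) :
    ∫⁻ z, f z.2 ∂π = ∫⁻ x, f x ∂ν := by
  rw [← hπ.2, lintegral_map hf measurable_snd]

theorem edist_sq_le_add {x y z : X} :
    edist x z ^ 2 ≤ 2 * edist x y ^ 2 + 2 * edist y z ^ 2 := by
  calc edist x z ^ 2 ≤ (edist x y + edist y z) ^ 2 := by gcongr; exact edist_triangle _ _ _
    _ ≤ 2 * (edist x y ^ 2 + edist y z ^ 2) := by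
        have h := ENNReal.rpow_add_le_mul_rpow_add_rpow (edist x y) (edist y z)
          (p := 2) (by norm_num)
        norm_num at h
        exact h
    _ = _ := by ring

variable [BorelSpace X] [SecondCountableTopology X]

theorem measurable_edist_sq : Measurable fun z : X × X => edist z.1 z.2 ^ 2 :=
  (measurable_fst.edist measurable_snd).pow_const 2

theorem transportCost_swap (π : Measure (X × X)) :
    transportCost (π.map Prod.swap) = transportCost π := by
  unfold transportCost
  rw [lintegral_map measurable_edist_sq measurable_swap]
  simp [edist_comm]

theorem W2_comm (μ ν : Measure X) : W2 μ ν = W2 ν μ := by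
  have key : ∀ μ ν : Measure X, W2 μ ν ^ 2 ≤ W2 ν μ ^ 2 := fun μ ν =>
    le_W2_sq fun π hπ => by
      rw [← transportCost_swap]; exact W2_sq_le (transportPlans_swap hπ)
  exact le_antisymm ((ENNReal.pow_le_pow_left_iff two_ne_zero).1 (key μ ν))
    ((ENNReal.pow_le_pow_left_iff two_ne_zero).1 (key ν μ))

theorem lintegral_edist_sq_le {μ ν : Measure X} {π : Measure (X × X)}
    (hπ : π ∈ transportPlans μ ν) (x₀ : X) :
    ∫⁻ x, edist x x₀ ^ 2 ∂ν ≤ 2 * transportCost π + 2 * ∫⁻ x, edist x x₀ ^ 2 ∂μ := by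
  have hm : Measurable fun x : X => edist x x₀ ^ 2 := (measurable_id.edist measurable_const).pow_const 2
  rw [← lintegral_comp_snd hπ hm, ← lintegral_comp_fst hπ hm, transportCost,
    ← lintegral_const_mul _ measurable_edist_sq,
    ← lintegral_const_mul (f := fun z : X × X => edist z.1 x₀ ^ 2) _ (hm.comp measurable_fst),
    ← lintegral_add_left (measurable_edist_sq.const_mul _)]
  refine lintegral_mono fun z => ?_
  simpa [edist_comm z.2 z.1] using edist_sq_le_add (x := z.2) (y := z.1) (z := x₀)

theorem transportCost_le {μ ν : Measure X} {π : Measure (X × X)}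
    (hπ : π ∈ transportPlans μ ν) (x₀ : X) :
    transportCost π ≤ 2 * ∫⁻ x, edist x x₀ ^ 2 ∂μ + 2 * ∫⁻ x, edist x x₀ ^ 2 ∂ν := by
  have hm : Measurable fun x : X => edist x x₀ ^ 2 := (measurable_id.edist measurable_const).pow_const 2
  rw [← lintegral_comp_snd hπ hm, ← lintegral_comp_fst hπ hm, transportCost,
    ← lintegral_const_mul (f := fun z : X × X => edist z.1 x₀ ^ 2) _ (hm.comp measurable_fst),
    ← lintegral_const_mul (f := fun z : X × X => edist z.2 x₀ ^ 2) _ (hm.comp measurable_snd),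
    ← lintegral_add_left (f := fun z : X × X => 2 * edist z.1 x₀ ^ 2)
      ((hm.comp measurable_fst).const_mul _)]
  refine lintegral_mono fun z => ?_
  simpa [edist_comm z.2 x₀] using edist_sq_le_add (x := z.1) (y := x₀) (z := z.2)

theorem lintegral_edist_sq_lt_top {μ : Measure X} (hμ : μ ∈ P2 X) (x₀ : X) :
    ∫⁻ x, edist x x₀ ^ 2 ∂μ < ∞ := by
  obtain ⟨hp, x₁, h⟩ := hμ
  have hm : Measurable fun x : X => edist x x₁ ^ 2 := (measurable_id.edist measurable_const).pow_const 2
  calc ∫⁻ x, edist x x₀ ^ 2 ∂μ ≤ ∫⁻ x, (2 * edist x x₁ ^ 2 + 2 * edist x₁ x₀ ^ 2) ∂μ :=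
        lintegral_mono fun x => edist_sq_le_add
    _ = 2 * ∫⁻ x, edist x x₁ ^ 2 ∂μ + 2 * edist x₁ x₀ ^ 2 := by
        rw [lintegral_add_left (hm.const_mul _), lintegral_const_mul _ hm]; simp
    _ < ∞ := ENNReal.add_lt_top.2 ⟨ENNReal.mul_lt_top (by simp) h,
        ENNReal.mul_lt_top (by simp) (ENNReal.pow_lt_top (edist_lt_top _ _))⟩

theorem W2_lt_top {μ ν : Measure X} (hμ : μ ∈ P2 X) (hν : ν ∈ P2 X) : W2 μ ν < ∞ := by
  obtain ⟨_, x₀, h⟩ := hμ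
  have := hν.1
  have h2 : W2 μ ν ^ 2 < ∞ := by
    refine (W2_sq_le (prod_mem_transportPlans μ ν)).trans_lt
      ((transportCost_le (prod_mem_transportPlans μ ν) x₀).trans_lt ?_)
    exact ENNReal.add_lt_top.2 ⟨ENNReal.mul_lt_top (by simp) h,
        ENNReal.mul_lt_top (by simp) (lintegral_edist_sq_lt_top hν x₀)⟩
  by_contra H
  simp [not_lt_top_iff.1 H] at h2

theorem mem_P2_of_W2_lt_top {μ ν : Measure X} [IsProbabilityMeasure ν] (hμ : μ ∈ P2 X)
    (h : W2 μ ν < ∞) : ν ∈ P2 X := by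
  obtain ⟨π, hπ, hc⟩ := exists_transportCost_lt (ENNReal.pow_lt_top h (n := 2))
  obtain ⟨_, x₀, hx⟩ := hμ
  exact ⟨inferInstance, x₀, (lintegral_edist_sq_le hπ x₀).trans_lt
    (ENNReal.add_lt_top.2 ⟨ENNReal.mul_lt_top (by simp) hc, ENNReal.mul_lt_top (by simp) hx⟩)⟩

theorem W2_map_le {Y : Type*} [MetricSpace Y] [MeasurableSpace Y] [BorelSpace Y]
    [SecondCountableTopology Y] {f : X → Y} (hf : LipschitzWith 1 f) (μ ν : Measure X) :
    W2 (μ.map f) (ν.map f) ≤ W2 μ ν := by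
  refine (ENNReal.pow_le_pow_left_iff two_ne_zero).1 (le_W2_sq fun π hπ => ?_)
  have hfm : Measurable f := hf.continuous.measurable
  have hg : Measurable (Prod.map f f) := hfm.prodMap hfm
  have hmem : π.map (Prod.map f f) ∈ transportPlans (μ.map f) (ν.map f) := by
    constructor
    · rw [Measure.map_map measurable_fst hg, ← hπ.1, Measure.map_map hfm measurable_fst]; rfl
    · rw [Measure.map_map measurable_snd hg, ← hπ.2, Measure.map_map hfm measurable_snd]; rfl
  refine (W2_sq_le hmem).trans ?_
  unfold transportCost
  rw [lintegral_map measurable_edist_sq hg]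
  refine lintegral_mono fun z => ?_
  have := hf z.1 z.2
  simp only [ENNReal.coe_one, one_mul] at this
  simp only [Prod.map_fst, Prod.map_snd]
  gcongr

/-- Cutting off at `N` makes a continuous function a legitimate test function for weak convergence.
Used for squared distances, where the cut-off is removed afterwards. -/
theorem tendsto_lintegral_min_of_tendsto {Z ι : Type*} [TopologicalSpace Z] [MeasurableSpace Z]
    [OpensMeasurableSpace Z] {l : Filter ι} {μ : ι → ProbabilityMeasure Z}
    {μ' : ProbabilityMeasure Z} (h : Tendsto μ l (𝓝 μ')) {f : Z → ℝ≥0} (hf : Continuous f)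
    (N : ℝ≥0) :
    Tendsto (fun i => ∫⁻ z, min (f z : ℝ≥0∞) N ∂(μ i : Measure Z)) l
      (𝓝 (∫⁻ z, min (f z : ℝ≥0∞) N ∂(μ' : Measure Z))) := by
  let g : BoundedContinuousFunction Z ℝ≥0 :=
    BoundedContinuousFunction.mkOfBound ⟨fun z => min (f z) N, by fun_prop⟩ N fun z w => by
      simp only [ContinuousMap.coe_mk]
      rw [NNReal.dist_eq, abs_le]
      have h1 : ((min (f z) N : ℝ≥0) : ℝ) ≤ N := NNReal.coe_le_coe.2 (min_le_right _ _)
      have h2 : ((min (f w) N : ℝ≥0) : ℝ) ≤ N := NNReal.coe_le_coe.2 (min_le_right _ _)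
      have h3 := NNReal.coe_nonneg (min (f z) N)
      have h4 := NNReal.coe_nonneg (min (f w) N)
      constructor <;> linarith
  have hg : ∀ z, ((g z : ℝ≥0) : ℝ≥0∞) = min (f z : ℝ≥0∞) N := fun z => ENNReal.coe_min _ _
  simpa only [hg] using ProbabilityMeasure.tendsto_iff_forall_lintegral_tendsto.1 h g

/-- Transport plans between tight families of probability measures subconverge to transport
plans between the limits, and the cost is lower semicontinuous. -/
theorem exists_plan_of_tendsto {ι : Type*} (U : Ultrafilter ι) {μ ν : ι → ProbabilityMeasure X}
    {μ' ν' : ProbabilityMeasure X}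
    (tμ : IsTightMeasureSet (range fun i => (μ i : Measure X)))
    (tν : IsTightMeasureSet (range fun i => (ν i : Measure X)))
    (hμ : Tendsto μ U (𝓝 μ')) (hν : Tendsto ν U (𝓝 ν')) {π : ι → Measure (X × X)}
    (hπ : ∀ i, π i ∈ transportPlans (μ i : Measure X) (ν i)) {B : ι → ℝ≥0∞} {b : ℝ≥0∞}
    (hB : Tendsto B U (𝓝 b)) (hc : ∀ᶠ i in U, transportCost (π i) ≤ B i) :
    ∃ π' ∈ transportPlans (μ' : Measure X) ν', transportCost π' ≤ b := by
  let P : ι → ProbabilityMeasure (X × X) := fun i =>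
    ⟨π i, isProbabilityMeasure_of_mem_transportPlans (hπ i)⟩
  -- Couplings of two tight families are tight, so Prokhorov's theorem gives a limit along the
  -- ultrafilter.
  have ht : IsTightMeasureSet {x | ∃ ρ ∈ range P, (ρ : Measure (X × X)) = x} := by
    apply IsTightMeasureSet.prodMk
    · refine tμ.subset ?_
      rintro _ ⟨_, ⟨_, ⟨i, rfl⟩, rfl⟩, rfl⟩
      exact ⟨i, (hπ i).1.symm⟩
    · refine tν.subset ?_
      rintro _ ⟨_, ⟨_, ⟨i, rfl⟩, rfl⟩, rfl⟩
      exact ⟨i, (hπ i).2.symm⟩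
  obtain ⟨ρ, -, hρ⟩ := (isCompact_closure_of_isTightMeasureSet ht).ultrafilter_le_nhds' (U.map P)
    (Ultrafilter.mem_map.2 (Filter.mem_of_superset univ_mem fun i _ =>
      subset_closure (mem_range_self i)))
  have hρ' : Tendsto P U (𝓝 ρ) := hρ
  refine ⟨ρ, ⟨?_, ?_⟩, ?_⟩
  · have h1 := ProbabilityMeasure.tendsto_map_of_tendsto_of_continuous P ρ hρ'
      (f := Prod.fst) continuous_fst
    have h2 : (fun i => (P i).map (f := Prod.fst) continuous_fst.measurable.aemeasurable) = μ := by
      funext i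
      exact Subtype.ext (hπ i).1
    rw [h2] at h1
    exact congrArg (fun q : ProbabilityMeasure X => (q : Measure X)) (tendsto_nhds_unique h1 hμ)
  · have h1 := ProbabilityMeasure.tendsto_map_of_tendsto_of_continuous P ρ hρ'
      (f := Prod.snd) continuous_snd
    have h2 : (fun i => (P i).map (f := Prod.snd) continuous_snd.measurable.aemeasurable) = ν := by
      funext i
      exact Subtype.ext (hπ i).2
    rw [h2] at h1
    exact congrArg (fun q : ProbabilityMeasure X => (q : Measure X)) (tendsto_nhds_unique h1 hν)
  · have hle : ∀ N : ℕ, ∫⁻ z, min (edist z.1 z.2 ^ 2) N ∂(ρ : Measure (X × X)) ≤ b := fun N => by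
      have h1 := tendsto_lintegral_min_of_tendsto hρ'
        (f := fun z : X × X => nndist z.1 z.2 ^ 2) (by fun_prop) N
      simp only [ENNReal.coe_pow, ← edist_nndist, ENNReal.coe_natCast] at h1
      refine le_of_tendsto_of_tendsto h1 hB ?_
      filter_upwards [hc] with i hi
      exact (lintegral_mono fun z => min_le_left _ _).trans hi
    have hsup : ∀ z : X × X, edist z.1 z.2 ^ 2 = ⨆ N : ℕ, min (edist z.1 z.2 ^ 2) (N : ℝ≥0∞) :=
      fun z => by
        refine le_antisymm ?_ (iSup_le fun N => min_le_left _ _)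
        obtain ⟨N, hN⟩ := ENNReal.exists_nat_gt
          (ENNReal.pow_ne_top (n := 2) (edist_ne_top z.1 z.2))
        exact le_iSup_of_le N (le_min le_rfl hN.le)
    unfold transportCost
    rw [lintegral_congr hsup, lintegral_iSup]
    · exact iSup_le hle
    · exact fun N => measurable_edist_sq.min measurable_const
    · intro N N' h z
      exact min_le_min le_rfl (by exact_mod_cast h)

/-! ### Optimal plans, lower semicontinuity of `W2`, gluing and the triangle inequality -/

variable [CompleteSpace X]

/-- The direct method: a minimising sequence has constant marginals, hence is tight, and the cost is
lower semicontinuous. If the distance is infinite, the product plan is already optimal. -/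
theorem exists_optimal_plan (μ ν : Measure X) [IsProbabilityMeasure μ] [IsProbabilityMeasure ν] :
    ∃ π ∈ transportPlans μ ν, transportCost π = W2 μ ν ^ 2 := by
  by_cases htop : W2 μ ν ^ 2 = ∞
  · exact ⟨_, prod_mem_transportPlans μ ν, top_le_iff.1
      (htop ▸ W2_sq_le (prod_mem_transportPlans μ ν)) |>.trans htop.symm⟩
  have h : ∀ n : ℕ, ∃ π ∈ transportPlans μ ν, transportCost π < W2 μ ν ^ 2 + ((n : ℝ≥0∞) + 1)⁻¹ :=
    fun n => exists_transportCost_lt (ENNReal.lt_add_right htop (by simp))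
  choose π hπ hlt using h
  have htend : Tendsto (fun n : ℕ => W2 μ ν ^ 2 + ((n : ℝ≥0∞) + 1)⁻¹) atTop (𝓝 (W2 μ ν ^ 2)) := by
    have h1 : Tendsto (fun n : ℕ => (((n + 1 : ℕ) : ℝ≥0∞))⁻¹) atTop (𝓝 0) :=
      ENNReal.tendsto_inv_nat_nhds_zero.comp (tendsto_add_atTop_nat 1)
    simpa using tendsto_const_nhds.add h1
  obtain ⟨π', hπ', hle⟩ := exists_plan_of_tendsto (hyperfilter ℕ)
    (μ := fun _ => ⟨μ, inferInstance⟩) (ν := fun _ => ⟨ν, inferInstance⟩)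
    (by simpa using isTightMeasureSet_singleton) (by simpa using isTightMeasureSet_singleton)
    tendsto_const_nhds tendsto_const_nhds hπ (htend.mono_left Nat.hyperfilter_le_atTop)
    (Eventually.of_forall fun n => (hlt n).le)
  exact ⟨π', hπ', le_antisymm hle (W2_sq_le hπ')⟩

theorem W2_sq_le_of_tendsto {ι : Type*} (U : Ultrafilter ι) {μ ν : ι → ProbabilityMeasure X}
    {μ' ν' : ProbabilityMeasure X}
    (tμ : IsTightMeasureSet (range fun i => (μ i : Measure X)))
    (tν : IsTightMeasureSet (range fun i => (ν i : Measure X)))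
    (hμ : Tendsto μ U (𝓝 μ')) (hν : Tendsto ν U (𝓝 ν')) {B : ι → ℝ≥0∞} {b : ℝ≥0∞}
    (hB : Tendsto B U (𝓝 b)) (hc : ∀ᶠ i in U, W2 (μ i : Measure X) (ν i) ^ 2 ≤ B i) :
    W2 (μ' : Measure X) ν' ^ 2 ≤ b := by
  choose π hπ hopt using fun i => exists_optimal_plan (μ i : Measure X) (ν i)
  obtain ⟨π', hπ', hle⟩ := exists_plan_of_tendsto U tμ tν hμ hν hπ hB
    (by filter_upwards [hc] with i hi using (hopt i).trans_le hi)
  exact (W2_sq_le hπ').trans hle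

/-- Two transport plans with a common marginal can be glued. The common marginal is the first
coordinate of the glued measure. -/
theorem exists_gluing {μ₀ μ₁ μ₂ : Measure X} [IsProbabilityMeasure μ₀] [IsProbabilityMeasure μ₁]
    {π π' : Measure (X × X)} (hπ : π ∈ transportPlans μ₀ μ₁) (hπ' : π' ∈ transportPlans μ₁ μ₂) :
    ∃ τ : Measure (X × X × X), τ.map (fun z => (z.2.1, z.1)) = π ∧
      τ.map (fun z => (z.1, z.2.2)) = π' := by
  have := isProbabilityMeasure_of_mem_transportPlans hπ
  have := isProbabilityMeasure_of_mem_transportPlans hπ'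
  have : Nonempty X := ⟨((nonempty_of_isProbabilityMeasure μ₀).some : X)⟩
  have hs := transportPlans_swap hπ
  have := isProbabilityMeasure_of_mem_transportPlans hs
  have e1 : μ₁ ⊗ₘ (π.map Prod.swap).condKernel = π.map Prod.swap := by
    have := (π.map Prod.swap).disintegrate (π.map Prod.swap).condKernel
    rwa [Measure.fst, hs.1] at this
  have e2 : μ₁ ⊗ₘ π'.condKernel = π' := by
    have := π'.disintegrate π'.condKernel
    rwa [Measure.fst, hπ'.1] at this
  -- Given the common point, the two outer points are drawn independently from the conditional laws
  -- of the two plans.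
  refine ⟨μ₁ ⊗ₘ ((π.map Prod.swap).condKernel ×ₖ π'.condKernel), ?_, ?_⟩
  · have h : (fun z : X × X × X => (z.2.1, z.1)) = Prod.swap ∘ Prod.map id Prod.fst := rfl
    rw [h, ← Measure.map_map measurable_swap (measurable_id.prodMap measurable_fst),
      ← Measure.compProd_map measurable_fst, ← Kernel.fst_eq, Kernel.fst_prod, e1,
      Measure.map_map measurable_swap measurable_swap]
    simp
  · have h : (fun z : X × X × X => (z.1, z.2.2)) = Prod.map id Prod.snd := rfl
    rw [h, ← Measure.compProd_map measurable_snd, ← Kernel.snd_eq, Kernel.snd_prod, e2]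

theorem gluing_mem_transportPlans {μ₀ μ₁ μ₂ : Measure X}
    {π π' : Measure (X × X)} (hπ : π ∈ transportPlans μ₀ μ₁) (hπ' : π' ∈ transportPlans μ₁ μ₂)
    {τ : Measure (X × X × X)} (h : τ.map (fun z => (z.2.1, z.1)) = π)
    (h' : τ.map (fun z => (z.1, z.2.2)) = π') : τ.map Prod.snd ∈ transportPlans μ₀ μ₂ := by
  constructor
  · rw [← hπ.1, ← h, Measure.map_map measurable_fst measurable_snd,
      Measure.map_map measurable_fst (by fun_prop)]; rfl
  · rw [← hπ'.2, ← h', Measure.map_map measurable_snd measurable_snd,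
      Measure.map_map measurable_snd (by fun_prop)]; rfl

/-- Glue two optimal plans and apply Minkowski's inequality in `L²` of the glued measure. -/
theorem W2_triangle (μ₀ μ₁ μ₂ : Measure X) [IsProbabilityMeasure μ₀] [IsProbabilityMeasure μ₁]
    [IsProbabilityMeasure μ₂] : W2 μ₀ μ₂ ≤ W2 μ₀ μ₁ + W2 μ₁ μ₂ := by
  obtain ⟨π, hπ, hc⟩ := exists_optimal_plan μ₀ μ₁
  obtain ⟨π', hπ', hc'⟩ := exists_optimal_plan μ₁ μ₂
  obtain ⟨τ, h, h'⟩ := exists_gluing hπ hπ'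
  have hle := W2_sq_le (gluing_mem_transportPlans hπ hπ' h h')
  rw [← h] at hc
  rw [← h'] at hc'
  unfold transportCost at hle hc hc'
  rw [lintegral_map measurable_edist_sq (by fun_prop)] at hle hc hc'
  have hM := ENNReal.lintegral_Lp_add_le (μ := τ) (p := 2)
    (f := fun z => edist z.2.1 z.1) (g := fun z => edist z.1 z.2.2)
    (by fun_prop) (by fun_prop) (by norm_num)
  simp only [Pi.add_apply, ENNReal.rpow_ofNat] at hM
  rw [hc, hc'] at hM
  have hs : ∀ a : ℝ≥0∞, (a ^ 2) ^ (1 / 2 : ℝ) = a := fun a => by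
    rw [← ENNReal.rpow_natCast, ← ENNReal.rpow_mul]; norm_num
  rw [hs, hs] at hM
  refine le_trans ?_ hM
  rw [← hs (W2 μ₀ μ₂)]
  refine ENNReal.rpow_le_rpow (hle.trans (lintegral_mono fun z => ?_)) (by norm_num)
  gcongr
  exact edist_triangle _ _ _

end Wasserstein

/-! ### Second moment tails of intermediate points -/

section Tail

variable {X : Type*} [MetricSpace X] [MeasurableSpace X] [BorelSpace X]
  [SecondCountableTopology X] [CompleteSpace X]

/-- The right-hand side exceeds `(d(x, y) + d(y, z))²` by a multiple of the square of `(1 - t) d(x,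
y) - t d(y, z)`. These weights lose nothing at a genuine `t`-intermediate point, which is why the
defect in `lintegral_tail_le` tends to zero. -/
theorem edist_sq_le_weighted {t : ℝ} (ht : t ∈ Ioo (0 : ℝ) 1) (x y z : X) :
    edist x z ^ 2 ≤ ENNReal.ofReal t⁻¹ * edist x y ^ 2
      + ENNReal.ofReal (1 - t)⁻¹ * edist y z ^ 2 := by
  have h0 : 0 < t := ht.1
  have h1 : 0 < 1 - t := sub_pos.2 ht.2
  simp only [edist_dist]
  rw [← ENNReal.ofReal_pow dist_nonneg, ← ENNReal.ofReal_pow dist_nonneg,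
    ← ENNReal.ofReal_pow dist_nonneg, ← ENNReal.ofReal_mul (by positivity),
    ← ENNReal.ofReal_mul (by positivity), ← ENNReal.ofReal_add (by positivity) (by positivity)]
  refine ENNReal.ofReal_le_ofReal ?_
  calc dist x z ^ 2 ≤ (dist x y + dist y z) ^ 2 := by gcongr; exact dist_triangle _ _ _
    _ = t⁻¹ * dist x y ^ 2 + (1 - t)⁻¹ * dist y z ^ 2
        - (t * (1 - t))⁻¹ * ((1 - t) * dist x y - t * dist y z) ^ 2 := by field_simp; ring
    _ ≤ _ := sub_le_self _ (by positivity)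

/-- Control of the second moment tails of an (almost) intermediate point by those of the
end points. -/
theorem lintegral_tail_le {μ₀ μ μ₁ : Measure X} [IsProbabilityMeasure μ₀] [IsProbabilityMeasure μ]
    [IsProbabilityMeasure μ₁] {t : ℝ} (ht : t ∈ Ioo (0 : ℝ) 1) {D : ℝ≥0∞} (hD : D ≠ ∞)
    (h₀ : W2 μ₀ μ ^ 2 ≤ ENNReal.ofReal t ^ 2 * D)
    (h₁ : W2 μ μ₁ ^ 2 ≤ ENNReal.ofReal (1 - t) ^ 2 * D) (o : X) (M : ℝ≥0∞) :
    ∫⁻ x, (edist x o ^ 2 - M) ∂μ ≤ ∫⁻ x, (6 * edist x o ^ 2 - M / 2) ∂μ₀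
      + ∫⁻ x, (4 * edist x o ^ 2 - M / 2) ∂μ₁ + 2 * (D - W2 μ₀ μ₁ ^ 2) := by
  have ht0 : 0 < t := ht.1
  have ht1 : 0 < 1 - t := sub_pos.2 ht.2
  obtain ⟨π, hπ, hc⟩ := exists_optimal_plan μ₀ μ
  obtain ⟨π', hπ', hc'⟩ := exists_optimal_plan μ μ₁
  obtain ⟨τ, h, h'⟩ := exists_gluing hπ hπ'
  have hplan := gluing_mem_transportPlans hπ hπ' h h'
  have hle := W2_sq_le hplan
  have e0 : τ.map (fun z => z.2.1) = μ₀ := by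
    rw [← hplan.1, Measure.map_map measurable_fst measurable_snd]; rfl
  have e1 : τ.map (fun z => z.2.2) = μ₁ := by
    rw [← hplan.2, Measure.map_map measurable_snd measurable_snd]; rfl
  have et : τ.map (fun z => z.1) = μ := by
    rw [← hπ'.1, ← h', Measure.map_map measurable_fst (by fun_prop)]; rfl
  have ha : ∫⁻ z, edist z.2.1 z.1 ^ 2 ∂τ ≤ ENNReal.ofReal t ^ 2 * D := by
    rw [← h] at hc
    unfold transportCost at hc
    rw [lintegral_map measurable_edist_sq (by fun_prop)] at hc
    exact hc.trans_le h₀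
  have hb : ∫⁻ z, edist z.1 z.2.2 ^ 2 ∂τ ≤ ENNReal.ofReal (1 - t) ^ 2 * D := by
    rw [← h'] at hc'
    unfold transportCost at hc'
    rw [lintegral_map measurable_edist_sq (by fun_prop)] at hc'
    exact hc'.trans_le h₁
  unfold transportCost at hle
  rw [lintegral_map measurable_edist_sq (by fun_prop)] at hle
  -- `A` dominates the squared distance of the end points, while its integral is at most `D`. The
  -- excess of `A` over that squared distance is thus nonnegative with integral at most `D - W2 μ₀
  -- μ₁ ^ 2`.
  let A : X × X × X → ℝ≥0∞ := fun z => ENNReal.ofReal t⁻¹ * edist z.2.1 z.1 ^ 2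
      + ENNReal.ofReal (1 - t)⁻¹ * edist z.1 z.2.2 ^ 2
  have hA : ∫⁻ z, A z ∂τ ≤ D := by
    rw [lintegral_add_left (by fun_prop), lintegral_const_mul _ (by fun_prop),
      lintegral_const_mul _ (by fun_prop)]
    calc _ ≤ ENNReal.ofReal t⁻¹ * (ENNReal.ofReal t ^ 2 * D)
          + ENNReal.ofReal (1 - t)⁻¹ * (ENNReal.ofReal (1 - t) ^ 2 * D) := by gcongr
      _ = ENNReal.ofReal (t⁻¹ * t ^ 2 + (1 - t)⁻¹ * (1 - t) ^ 2) * D := by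
          rw [← mul_assoc, ← mul_assoc, ← add_mul, ← ENNReal.ofReal_pow ht0.le,
            ← ENNReal.ofReal_pow ht1.le, ← ENNReal.ofReal_mul (by positivity),
            ← ENNReal.ofReal_mul (by positivity),
            ← ENNReal.ofReal_add (by positivity) (by positivity)]
      _ = D := by
          have : t⁻¹ * t ^ 2 + (1 - t)⁻¹ * (1 - t) ^ 2 = 1 := by field_simp; ring
          rw [this]; simp
  have hcA : ∀ z : X × X × X, edist z.2.1 z.2.2 ^ 2 ≤ A z := fun z => edist_sq_le_weighted ht _ _ _
  have hq : ∫⁻ z, (A z - edist z.2.1 z.2.2 ^ 2) ∂τ ≤ D - W2 μ₀ μ₁ ^ 2 := by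
    rw [lintegral_sub (by fun_prop)
      (ne_top_of_le_ne_top hD ((lintegral_mono hcA).trans hA)) (Eventually.of_forall hcA)]
    exact tsub_le_tsub hA hle
  -- The intermediate point is compared with `o` through the first end point. Passing through `A`
  -- costs `4` at each end, and the direct distance from the first end point to `o` adds `2` there,
  -- whence `6` and `4`.
  have hpt : ∀ z : X × X × X, edist z.1 o ^ 2 - M ≤ (6 * edist z.2.1 o ^ 2 - M / 2)
      + (4 * edist z.2.2 o ^ 2 - M / 2) + 2 * (A z - edist z.2.1 z.2.2 ^ 2) := fun z => by
    rw [tsub_le_iff_right]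
    have haA : edist z.2.1 z.1 ^ 2 ≤ A z := by
      refine le_add_right (le_mul_of_one_le_left' ?_)
      rw [← ENNReal.ofReal_one]
      exact ENNReal.ofReal_le_ofReal (one_le_inv₀ ht0 |>.2 ht.2.le)
    have k1 : edist z.1 o ^ 2 ≤ 2 * edist z.2.1 z.1 ^ 2 + 2 * edist z.2.1 o ^ 2 := by
      simpa [edist_comm] using edist_sq_le_add (x := z.1) (y := z.2.1) (z := o)
    have k2 : edist z.2.1 z.2.2 ^ 2 ≤ 2 * edist z.2.1 o ^ 2 + 2 * edist z.2.2 o ^ 2 := by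
      simpa [edist_comm] using edist_sq_le_add (x := z.2.1) (y := o) (z := z.2.2)
    have k3 : A z = (A z - edist z.2.1 z.2.2 ^ 2) + edist z.2.1 z.2.2 ^ 2 :=
      (tsub_add_cancel_of_le (hcA z)).symm
    calc edist z.1 o ^ 2 ≤ 2 * ((A z - edist z.2.1 z.2.2 ^ 2)
            + (2 * edist z.2.1 o ^ 2 + 2 * edist z.2.2 o ^ 2)) + 2 * edist z.2.1 o ^ 2 := by
          refine k1.trans ?_
          gcongr
          exact haA.trans (k3.le.trans (by gcongr))
      _ = 6 * edist z.2.1 o ^ 2 + 4 * edist z.2.2 o ^ 2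
            + 2 * (A z - edist z.2.1 z.2.2 ^ 2) := by ring
      _ ≤ ((6 * edist z.2.1 o ^ 2 - M / 2) + M / 2) + ((4 * edist z.2.2 o ^ 2 - M / 2) + M / 2)
            + 2 * (A z - edist z.2.1 z.2.2 ^ 2) := by gcongr <;> exact le_tsub_add
      _ = (6 * edist z.2.1 o ^ 2 - M / 2) + (4 * edist z.2.2 o ^ 2 - M / 2)
            + 2 * (A z - edist z.2.1 z.2.2 ^ 2) + (M / 2 + M / 2) := by ring
      _ = _ := by rw [ENNReal.add_halves]
  have hf : ∀ (a b : ℝ≥0∞), Measurable fun x : X => a * edist x o ^ 2 - b := fun a b => by fun_prop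
  have hf' : Measurable fun x : X => edist x o ^ 2 - M := by fun_prop
  rw [← e0, ← e1]
  conv_lhs => rw [← et]
  rw [lintegral_map (hf 6 _) (by fun_prop), lintegral_map (hf 4 _) (by fun_prop),
    lintegral_map hf' (by fun_prop)]
  refine (lintegral_mono hpt).trans ?_
  rw [lintegral_add_left (by fun_prop), lintegral_add_left (by fun_prop),
    lintegral_const_mul _ (by fun_prop), e0, e1]
  gcongr

end Tail

/-! ### The relative entropy -/

section Entropy

variable {X : Type*} [MeasurableSpace X] {m μ : Measure X}

/-- Young's inequality for the convex conjugate pair `u log u - u` and `exp`; equality at `h = log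
u` underlies the dual description of the entropy. -/
theorem Real.mul_add_sub_exp_le {u : ℝ} (hu : 0 ≤ u) (h : ℝ) :
    u * h + u - Real.exp h ≤ u * Real.log u := by
  rcases hu.eq_or_lt with rfl | hu
  · simpa using (Real.exp_pos h).le
  have h1 := Real.add_one_le_exp (h - Real.log u)
  rw [Real.exp_sub, Real.exp_log hu, le_div_iff₀ hu] at h1
  nlinarith

theorem measurable_entropyDensity (m μ : Measure X) : Measurable (entropyDensity m μ) := by
  unfold entropyDensity
  have : Measurable fun x => (μ.rnDeriv m x).toReal := (μ.measurable_rnDeriv m).ennreal_toReal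
  exact this.mul (Real.measurable_log.comp this)

theorem Ent_eq_integral (hac : μ ≪ m) (hi : Integrable (entropyDensity m μ) m) :
    Ent m μ = ((∫ x, entropyDensity m μ x ∂m : ℝ) : EReal) := by
  have h1 := hi.lintegral_lt_top
  have h2 : ∫⁻ x, ENNReal.ofReal (-entropyDensity m μ x) ∂m < ∞ := hi.neg.lintegral_lt_top
  have key : ∀ a : ℝ≥0∞, a ≠ ∞ → (a : EReal) = ((a.toReal : ℝ) : EReal) := fun a ha => by
    lift a to ℝ≥0 using ha
    rfl
  rw [Ent, if_pos ⟨hac, h1⟩, integral_eq_lintegral_pos_part_sub_lintegral_neg_part hi,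
    EReal.coe_sub, ← key _ h1.ne, ← key _ h2.ne]

theorem absolutelyContinuous_of_Ent_lt_top (h : Ent m μ < ⊤) : μ ≪ m := by
  by_contra H
  simp [Ent, H] at h

theorem lintegral_entropyDensity_lt_top (h : Ent m μ < ⊤) :
    ∫⁻ x, ENNReal.ofReal (entropyDensity m μ x) ∂m < ∞ := by
  by_contra H
  rw [Ent, if_neg (fun h' => H h'.2)] at h
  exact lt_irrefl _ h

variable [SigmaFinite m] [IsProbabilityMeasure μ]

theorem integrable_rnDeriv_mul (hac : μ ≪ m) {f : X → ℝ} (hf : Integrable f μ) :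
    Integrable (fun x => (μ.rnDeriv m x).toReal * f x) m :=
  (integrable_rnDeriv_smul_iff hac).2 hf

theorem integral_rnDeriv_mul (hac : μ ≪ m) (f : X → ℝ) :
    ∫ x, (μ.rnDeriv m x).toReal * f x ∂m = ∫ x, f x ∂μ :=
  integral_rnDeriv_smul hac

theorem integral_rnDeriv_eq_one (hac : μ ≪ m) : ∫ x, (μ.rnDeriv m x).toReal ∂m = 1 := by
  rw [Measure.integral_toReal_rnDeriv hac]; simp

/-- The positive part is integrable because the entropy is not `⊤`; Young's inequality with `h`
bounds the density below by an integrable function, which controls the negative part. Under (VG), `h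
= -C² d(·, o)²` qualifies for every measure in `P2`. -/
theorem integrable_entropyDensity (hE : Ent m μ < ⊤) {h : X → ℝ} (hi : Integrable h μ)
    (he : Integrable (fun x => Real.exp (h x)) m) : Integrable (entropyDensity m μ) m := by
  have hac := absolutelyContinuous_of_Ent_lt_top hE
  have hL : Integrable (fun x => (μ.rnDeriv m x).toReal * h x + (μ.rnDeriv m x).toReal
      - Real.exp (h x)) m :=
    ((integrable_rnDeriv_mul hac hi).add Measure.integrable_toReal_rnDeriv).sub he
  have hle : ∀ x, (μ.rnDeriv m x).toReal * h x + (μ.rnDeriv m x).toReal - Real.exp (h x)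
      ≤ entropyDensity m μ x := fun x => Real.mul_add_sub_exp_le ENNReal.toReal_nonneg _
  refine ⟨(measurable_entropyDensity m μ).aestronglyMeasurable, ?_⟩
  have hb : ∀ x, ‖entropyDensity m μ x‖ₑ ≤ ENNReal.ofReal (entropyDensity m μ x)
      + ‖(μ.rnDeriv m x).toReal * h x + (μ.rnDeriv m x).toReal - Real.exp (h x)‖ₑ := fun x => by
    rcases le_total 0 (entropyDensity m μ x) with h0 | h0
    · rw [Real.enorm_eq_ofReal h0]; exact le_self_add
    · refine le_add_left ?_
      rw [← enorm_neg, Real.enorm_eq_ofReal (by linarith), ← enorm_neg,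
        Real.enorm_eq_ofReal (by linarith [hle x])]
      exact ENNReal.ofReal_le_ofReal (by linarith [hle x])
  refine (lintegral_mono hb).trans_lt ?_
  rw [lintegral_add_left (measurable_entropyDensity m μ).ennreal_ofReal]
  exact ENNReal.add_lt_top.2 ⟨lintegral_entropyDensity_lt_top hE, hL.2⟩

/-- The Donsker–Varadhan (Gibbs) lower bound for the entropy. -/
theorem integral_add_one_sub_le_of_Ent_le {E : ℝ} (hE : Ent m μ ≤ E) {h : X → ℝ}
    (hi : Integrable h μ) (he : Integrable (fun x => Real.exp (h x)) m) :
    ∫ x, h x ∂μ + 1 - ∫ x, Real.exp (h x) ∂m ≤ E := by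
  have hlt : Ent m μ < ⊤ := hE.trans_lt (EReal.coe_lt_top E)
  have hac := absolutelyContinuous_of_Ent_lt_top hlt
  have hφ := integrable_entropyDensity hlt hi he
  have hL : Integrable (fun x => (μ.rnDeriv m x).toReal * h x + (μ.rnDeriv m x).toReal) m :=
    (integrable_rnDeriv_mul hac hi).add Measure.integrable_toReal_rnDeriv
  rw [Ent_eq_integral hac hφ, EReal.coe_le_coe_iff] at hE
  refine le_trans ?_ hE
  rw [← integral_rnDeriv_mul hac h, ← integral_rnDeriv_eq_one hac,
    ← integral_add (integrable_rnDeriv_mul hac hi) Measure.integrable_toReal_rnDeriv,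
    ← integral_sub hL he]
  exact integral_mono (hL.sub he) hφ fun x => Real.mul_add_sub_exp_le ENNReal.toReal_nonneg _

theorem integrable_log_rnDeriv (hE : Ent m μ < ⊤) {h : X → ℝ} (hi : Integrable h μ)
    (he : Integrable (fun x => Real.exp (h x)) m) :
    Integrable (fun x => Real.log (μ.rnDeriv m x).toReal) μ :=
  (integrable_rnDeriv_smul_iff (absolutelyContinuous_of_Ent_lt_top hE)).1
    (integrable_entropyDensity hE hi he)

theorem Ent_eq_integral_log (hE : Ent m μ < ⊤) {h : X → ℝ} (hi : Integrable h μ)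
    (he : Integrable (fun x => Real.exp (h x)) m) :
    Ent m μ = ((∫ x, Real.log (μ.rnDeriv m x).toReal ∂μ : ℝ) : EReal) := by
  have hac := absolutelyContinuous_of_Ent_lt_top hE
  rw [Ent_eq_integral hac (integrable_entropyDensity hE hi he),
    ← integral_rnDeriv_mul hac]
  rfl

/-- The density `u` of `μ` is at most `v`, so `u log u ≤ u log v` by monotonicity of the logarithm.
The negative part of `u log u` may have infinite integral; the entropy is then `-∞` and the bound is
trivial. -/
theorem Ent_le_of_le_withDensity {v : X → ℝ} (hv0 : ∀ x, 0 ≤ v x)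
    (hle : μ ≤ m.withDensity fun x => ENNReal.ofReal (v x))
    (hi : Integrable (fun x => Real.log (v x)) μ) :
    Ent m μ ≤ ((∫ x, Real.log (v x) ∂μ : ℝ) : EReal) := by
  have hac : μ ≪ m := (Measure.absolutelyContinuous_of_le hle).trans
    (withDensity_absolutelyContinuous _ _)
  have hu : μ.rnDeriv m ≤ᵐ[m] fun x => ENNReal.ofReal (v x) := by
    refine ae_le_of_forall_setLIntegral_le_of_sigmaFinite (μ.measurable_rnDeriv m)
      fun s hs _ => ?_
    rw [Measure.setLIntegral_rnDeriv hac, ← withDensity_apply _ hs]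
    exact hle s
  have hle' : ∀ᵐ x ∂m, entropyDensity m μ x ≤ (μ.rnDeriv m x).toReal * Real.log (v x) := by
    filter_upwards [hu] with x hx
    have h1 : (μ.rnDeriv m x).toReal ≤ v x := ENNReal.toReal_le_of_le_ofReal (hv0 x) hx
    have h0 : 0 ≤ (μ.rnDeriv m x).toReal := ENNReal.toReal_nonneg
    unfold entropyDensity
    rcases h0.eq_or_lt with h | h
    · simp [← h]
    · gcongr
  have hiv := integrable_rnDeriv_mul hac hi
  have hP : ∫⁻ x, ENNReal.ofReal (entropyDensity m μ x) ∂m < ∞ := by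
    refine (lintegral_mono_ae ?_).trans_lt hiv.lintegral_lt_top
    filter_upwards [hle'] with x hx using ENNReal.ofReal_le_ofReal hx
  by_cases hN : ∫⁻ x, ENNReal.ofReal (-entropyDensity m μ x) ∂m = ∞
  · rw [Ent, if_pos ⟨hac, hP⟩, hN]
    simp
  have hφ : Integrable (entropyDensity m μ) m := by
    refine ⟨(measurable_entropyDensity m μ).aestronglyMeasurable, ?_⟩
    have hb : ∀ x, ‖entropyDensity m μ x‖ₑ ≤ ENNReal.ofReal (entropyDensity m μ x)
        + ENNReal.ofReal (-entropyDensity m μ x) := fun x => by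
      rcases le_total 0 (entropyDensity m μ x) with h0 | h0
      · rw [Real.enorm_eq_ofReal h0]; exact le_self_add
      · rw [← enorm_neg, Real.enorm_eq_ofReal (by linarith)]
        exact le_add_self
    refine (lintegral_mono hb).trans_lt ?_
    rw [lintegral_add_left (measurable_entropyDensity m μ).ennreal_ofReal]
    exact ENNReal.add_lt_top.2 ⟨hP, lt_top_iff_ne_top.2 hN⟩
  rw [Ent_eq_integral hac hφ, EReal.coe_le_coe_iff, ← integral_rnDeriv_mul hac]
  exact integral_mono_ae hφ hiv hle'

/-- The functional form of the entropy bound, for bounded continuous test functions, extends to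
bounded measurable ones. -/
theorem integral_bound_of_boundedContinuous {Y : Type*} [MetricSpace Y] [MeasurableSpace Y]
    [BorelSpace Y] {n ν : Measure Y} [IsFiniteMeasure n] [IsFiniteMeasure ν] {E : ℝ}
    (H : ∀ b : BoundedContinuousFunction Y ℝ, ∫ y, b y ∂ν - ∫ y, Real.exp (b y) ∂n ≤ E)
    {b : Y → ℝ} (hb : Measurable b) {M : ℝ} (hM : ∀ y, |b y| ≤ M) :
    ∫ y, b y ∂ν - ∫ y, Real.exp (b y) ∂n ≤ E := by
  have hexp : ∀ {x y : ℝ}, |x| ≤ M → |y| ≤ M →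
      |Real.exp x - Real.exp y| ≤ Real.exp M * |x - y| := fun {x y} hx hy => by
    have h1 : ∀ {x y : ℝ}, |x| ≤ M → Real.exp x - Real.exp y ≤ Real.exp M * |x - y| :=
      fun {x y} hx => by
        have h2 := Real.add_one_le_exp (y - x)
        have h3 : Real.exp y = Real.exp x * Real.exp (y - x) := by rw [← Real.exp_add]; ring_nf
        have h4 : Real.exp x ≤ Real.exp M := Real.exp_le_exp.2 ((le_abs_self x).trans hx)
        have h5 : Real.exp x * (x - y) ≤ Real.exp M * |x - y| :=
          (mul_le_mul_of_nonneg_left (le_abs_self _) (Real.exp_pos x).le).trans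
            (mul_le_mul_of_nonneg_right h4 (abs_nonneg _))
        nlinarith [Real.exp_pos x]
    rw [abs_le]
    constructor
    · have := h1 (x := y) (y := x) hy
      rw [abs_sub_comm] at this
      linarith
    · exact h1 hx
  have hint : ∀ (ρ : Measure Y) [IsFiniteMeasure ρ] {f : Y → ℝ}, Measurable f →
      (∃ C, ∀ y, |f y| ≤ C) → Integrable f ρ := fun ρ _ f hf ⟨C, hC⟩ =>
    Integrable.of_bound hf.aestronglyMeasurable C (Eventually.of_forall hC)
  have hM0 : ∀ y : Y, 0 ≤ M := fun y => (abs_nonneg _).trans (hM y)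
  refine le_of_forall_pos_le_add fun ε hε => ?_
  -- One approximation in `L¹(n + ν)` serves both integrals. Since `exp` is `exp M`-Lipschitz on
  -- `[-M, M]`, the total error is at most `1 + exp M` times the `L¹` error.
  obtain ⟨g, hg, -⟩ := (hint (n + ν) hb ⟨M, hM⟩).exists_boundedContinuous_integral_sub_le
    (ε := ε / (1 + Real.exp M)) (by positivity)
  -- Clipping to `[-M, M]` is `1`-Lipschitz and fixes `b`, so it keeps the approximation while
  -- bringing it into the range where the Lipschitz bound for `exp` holds.
  let c : BoundedContinuousFunction Y ℝ := BoundedContinuousFunction.ofNormedAddCommGroup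
    (fun y => max (-M) (min (g y) M)) (by fun_prop) |M| fun y => by
      rw [Real.norm_eq_abs]
      exact (abs_le.2 ⟨le_max_left _ _, max_le (by linarith [hM0 y]) (min_le_right _ _)⟩).trans
        (le_abs_self M)
  have hc : ∀ y, c y = max (-M) (min (g y) M) := fun y => rfl
  have hcM : ∀ y, |c y| ≤ M := fun y => by
    rw [hc]; exact abs_le.2 ⟨le_max_left _ _, max_le (by linarith [hM0 y]) (min_le_right _ _)⟩
  have hbc : ∀ y, |b y - c y| ≤ ‖b y - g y‖ := fun y => by
    have hb1 : b y = max (-M) (min (b y) M) := by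
      rw [min_eq_left (abs_le.1 (hM y)).2, max_eq_right (abs_le.1 (hM y)).1]
    rw [hc, Real.norm_eq_abs]
    conv_lhs => rw [hb1]
    refine (abs_max_sub_max_le_max _ _ _ _).trans ?_
    rw [sub_self, abs_zero]
    refine max_le (abs_nonneg _) ((abs_min_sub_min_le_max _ _ _ _).trans ?_)
    rw [sub_self, abs_zero]
    exact max_le le_rfl (abs_nonneg _)
  have hcm : Measurable c := c.continuous.measurable
  have hdm : Measurable fun y => |b y - c y| := (hb.sub hcm).abs
  have hdb : ∃ C, ∀ y, |(|b y - c y|)| ≤ C := ⟨M + M, fun y => by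
    rw [abs_abs]; exact (abs_sub _ _).trans (add_le_add (hM y) (hcM y))⟩
  have hgi : ∀ (ρ : Measure Y) [IsFiniteMeasure ρ], Integrable (fun y => ‖b y - g y‖) ρ :=
    fun ρ _ => ((hint ρ hb ⟨M, hM⟩).sub (g.integrable ρ)).norm
  have hsum : ∫ y, |b y - c y| ∂n + ∫ y, |b y - c y| ∂ν ≤ ε / (1 + Real.exp M) := by
    rw [← integral_add_measure (hint n hdm hdb) (hint ν hdm hdb)]
    exact (integral_mono (hint _ hdm hdb) (hgi _) hbc).trans hg
  have hexpb : ∀ {f : Y → ℝ}, (∀ y, |f y| ≤ M) → ∃ C, ∀ y, |Real.exp (f y)| ≤ C :=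
    fun {f} hf => ⟨Real.exp M, fun y => by
      rw [Real.abs_exp]; exact Real.exp_le_exp.2 ((le_abs_self _).trans (hf y))⟩
  have k1 : ∫ y, b y ∂ν - ∫ y, c y ∂ν ≤ ∫ y, |b y - c y| ∂ν := by
    rw [← integral_sub (hint ν hb ⟨M, hM⟩) (c.integrable ν)]
    exact integral_mono ((hint ν hb ⟨M, hM⟩).sub (c.integrable ν)) (hint ν hdm hdb)
      fun y => le_abs_self _
  have k2 : ∫ y, Real.exp (c y) ∂n - ∫ y, Real.exp (b y) ∂n
      ≤ Real.exp M * ∫ y, |b y - c y| ∂n := by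
    have i1 : Integrable (fun y => Real.exp (c y)) n :=
      hint n (Real.measurable_exp.comp hcm) (hexpb hcM)
    have i2 : Integrable (fun y => Real.exp (b y)) n :=
      hint n (Real.measurable_exp.comp hb) (hexpb hM)
    rw [← integral_sub i1 i2, ← integral_const_mul]
    refine integral_mono (i1.sub i2) ((hint n hdm hdb).const_mul _) fun y => ?_
    have := hexp (hcM y) (hM y)
    rw [abs_sub_comm (c y)] at this
    exact (le_abs_self _).trans this
  have k3 := H c
  have p1 : 0 ≤ ∫ y, |b y - c y| ∂n := integral_nonneg fun y => abs_nonneg _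
  have p2 : 0 ≤ ∫ y, |b y - c y| ∂ν := integral_nonneg fun y => abs_nonneg _
  rw [le_div_iff₀ (by positivity)] at hsum
  nlinarith [mul_nonneg p2 (Real.exp_pos M).le]

end Entropy

/-! ### Duality: entropy from bounded test functions -/

section Variational

/-- Write `σ` for the clamped value. Clamping to `[N⁻¹, N]` moves `s` towards `1` when it moves it
at all, so `(s - σ) log σ ≥ 0`, and `σ log σ - σ ≥ -1`. This lower bound, uniform in `N`, is what
allows Fatou's lemma below. -/
theorem Real.neg_one_le_mul_log_clamp_sub {s N : ℝ} (hN : 1 ≤ N) :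
    -1 ≤ s * Real.log (max N⁻¹ (min s N)) - max N⁻¹ (min s N) := by
  have hN0 : 0 < N := by linarith
  have hinv : N⁻¹ ≤ 1 := inv_le_one_of_one_le₀ hN
  set σ := max N⁻¹ (min s N) with hσ
  have hσ0 : 0 < σ := lt_of_lt_of_le (by positivity) (le_max_left _ _)
  have h1 : -1 ≤ σ * Real.log σ - σ := by
    have := Real.mul_add_sub_exp_le hσ0.le 0
    simp at this
    linarith
  have h2 : 0 ≤ (s - σ) * Real.log σ := by
    rcases le_total s N with h | h
    · rcases le_total N⁻¹ s with h' | h'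
      · have : σ = s := by rw [hσ, min_eq_left h, max_eq_right h']
        rw [this]; simp
      · have e : σ = N⁻¹ := by rw [hσ, min_eq_left h, max_eq_left h']
        rw [e]
        exact mul_nonneg_of_nonpos_of_nonpos (by linarith)
          (Real.log_nonpos (by positivity) hinv)
    · have e : σ = N := by rw [hσ, min_eq_right h, max_eq_right (hinv.trans hN)]
      rw [e]
      exact mul_nonneg (by linarith) (Real.log_nonneg hN)
  nlinarith

theorem Real.abs_log_clamp_le (s : ℝ) {N : ℝ} (hN : 1 ≤ N) :
    |Real.log (max N⁻¹ (min s N))| ≤ Real.log N := by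
  have hN0 : 0 < N := by linarith
  have hinv : N⁻¹ ≤ 1 := inv_le_one_of_one_le₀ hN
  rw [abs_le]
  constructor
  · rw [← Real.log_inv]
    exact Real.log_le_log (by positivity) (le_max_left _ _)
  · exact Real.log_le_log (lt_of_lt_of_le (by positivity) (le_max_left _ _))
      (max_le (hinv.trans hN) (min_le_right _ _))

theorem tendsto_mul_log_clamp_sub {s : ℝ} (hs : 0 ≤ s) :
    Tendsto (fun k : ℕ => s * Real.log (max ((k : ℝ) + 1)⁻¹ (min s (k + 1)))
      - max ((k : ℝ) + 1)⁻¹ (min s (k + 1))) atTop (𝓝 (s * Real.log s - s)) := by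
  have hinv : Tendsto (fun k : ℕ => ((k : ℝ) + 1)⁻¹) atTop (𝓝 0) := by
    simpa using tendsto_one_div_add_atTop_nhds_zero_nat (𝕜 := ℝ)
  have hmin : ∀ᶠ k : ℕ in atTop, min s ((k : ℝ) + 1) = s := by
    obtain ⟨k₀, hk₀⟩ := exists_nat_ge s
    filter_upwards [eventually_ge_atTop k₀] with k hk
    have : (k₀ : ℝ) ≤ k := by exact_mod_cast hk
    exact min_eq_left (by linarith)
  rcases hs.eq_or_lt with rfl | hs
  · have h : Tendsto (fun k : ℕ => -((k : ℝ) + 1)⁻¹) atTop (𝓝 (-0)) := hinv.neg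
    simp only [zero_mul, zero_sub, sub_zero, neg_zero] at h ⊢
    refine h.congr' ?_
    filter_upwards [hmin] with k hk
    rw [hk, max_eq_left (by positivity)]
  · refine tendsto_const_nhds.congr' ?_
    filter_upwards [hmin, hinv.eventually_le_const hs] with k hk hk'
    rw [hk, max_eq_right hk']

/-- The variational characterisation of the entropy: a bound on all the functionals
`b ↦ ∫ (b + h) dν + 1 - ∫ exp (b + h) dm`, `b` bounded continuous, bounds the entropy. -/
theorem Ent_le_of_boundedContinuous {Y : Type*} [MetricSpace Y] [MeasurableSpace Y]
    [BorelSpace Y] {m ν : Measure Y} [SigmaFinite m] [IsProbabilityMeasure ν] {E : ℝ} {h : Y → ℝ}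
    (hm : Measurable h) (hi : Integrable h ν) (he : Integrable (fun y => Real.exp (h y)) m)
    (H : ∀ b : BoundedContinuousFunction Y ℝ,
      ∫ y, b y ∂ν + ∫ y, h y ∂ν + 1 - ∫ y, Real.exp (b y + h y) ∂m ≤ E) :
    Ent m ν ≤ E := by
  have hbdd : ∀ {b : Y → ℝ} {M : ℝ}, Measurable b → (∀ y, |b y| ≤ M) →
      ∫ y, b y ∂ν + ∫ y, h y ∂ν + 1 - ∫ y, Real.exp (b y + h y) ∂m ≤ E := by
    intro b M hb hM
    have hn : IsFiniteMeasure (m.withDensity fun y => ENNReal.ofReal (Real.exp (h y))) :=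
      isFiniteMeasure_withDensity_ofReal he.2
    have hint : ∀ b : Y → ℝ, ∫ y, Real.exp (b y)
          ∂(m.withDensity fun y => ENNReal.ofReal (Real.exp (h y)))
        = ∫ y, Real.exp (b y + h y) ∂m := fun b => by
      rw [integral_withDensity_eq_integral_toReal_smul
        (f := fun y => ENNReal.ofReal (Real.exp (h y))) (Real.measurable_exp.comp hm).ennreal_ofReal
        (Eventually.of_forall fun y => ENNReal.ofReal_lt_top)]
      refine integral_congr_ae (Eventually.of_forall fun y => ?_)
      simp only [smul_eq_mul, ENNReal.toReal_ofReal (Real.exp_pos _).le, Real.exp_add]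
      ring
    have := integral_bound_of_boundedContinuous
      (n := m.withDensity fun y => ENNReal.ofReal (Real.exp (h y))) (ν := ν)
      (E := E - 1 - ∫ y, h y ∂ν) (fun b => by rw [hint]; linarith [H b]) hb hM
    rw [hint] at this
    linarith
  -- If `A` is `m`-null, testing with `N` times its indicator leaves the exponential integral
  -- unchanged, so `N ν(A)` stays bounded as `N` grows.
  have hac : ν ≪ m := by
    refine Measure.AbsolutelyContinuous.mk fun A hA hA0 => ?_
    by_contra hne
    have hpos : 0 < ν.real A := ENNReal.toReal_pos hne (measure_ne_top _ _)
    obtain ⟨N, hN⟩ := exists_nat_gt ((E - 1 - ∫ y, h y ∂ν + ∫ y, Real.exp (h y) ∂m) / ν.real A)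
    rw [div_lt_iff₀ hpos] at hN
    have h1 := hbdd (b := A.indicator fun _ => (N : ℝ)) (M := N) (measurable_const.indicator hA)
      fun y => by
        by_cases hy : y ∈ A <;> simp [hy]
    have h2 : ∫ y, Real.exp (A.indicator (fun _ => (N : ℝ)) y + h y) ∂m
        = ∫ y, Real.exp (h y) ∂m := by
      refine integral_congr_ae ?_
      filter_upwards [measure_eq_zero_iff_ae_notMem.1 hA0] with y hy
      simp [hy]
    rw [h2, integral_indicator_const _ hA, smul_eq_mul] at h1
    linarith
  set r : Y → ℝ := fun y => (ν.rnDeriv m y).toReal with hr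
  have hrm : Measurable r := (ν.measurable_rnDeriv m).ennreal_toReal
  have hr0 : ∀ y, 0 ≤ r y := fun y => ENNReal.toReal_nonneg
  have hri : Integrable r m := Measure.integrable_toReal_rnDeriv
  -- `s` is the density of `ν` with respect to the finite measure `exp h · m`. The optimal `b` would
  -- be `log s`; its clamped versions `log (σ k)` are admissible, and `G k` is the corresponding
  -- integrand, shifted by `exp h` to be nonnegative.
  let s : Y → ℝ := fun y => r y * Real.exp (-h y)
  have hsm : Measurable s := hrm.mul (Real.measurable_exp.comp hm.neg)
  have hs0 : ∀ y, 0 ≤ s y := fun y => mul_nonneg (hr0 y) (Real.exp_pos _).le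
  have hes : ∀ y, Real.exp (h y) * s y = r y := fun y => by
    simp only [s]
    rw [mul_left_comm, ← Real.exp_add]; simp
  let σ : ℕ → Y → ℝ := fun k y => max ((k : ℝ) + 1)⁻¹ (min (s y) (k + 1))
  have hσm : ∀ k, Measurable (σ k) := fun k =>
    measurable_const.max (hsm.min measurable_const)
  have hk1 : ∀ k : ℕ, (1 : ℝ) ≤ k + 1 := fun k => by
    have : (0 : ℝ) ≤ k := Nat.cast_nonneg k
    linarith
  have hσ0 : ∀ k y, 0 < σ k y := fun k y =>
    lt_of_lt_of_le (by positivity) (le_max_left _ _)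
  have hσ1 : ∀ k y, σ k y ≤ k + 1 := fun k y =>
    max_le ((inv_le_one_of_one_le₀ (hk1 k)).trans (hk1 k)) (min_le_right _ _)
  let G : ℕ → Y → ℝ := fun k y =>
    Real.exp (h y) * (s y * Real.log (σ k y) - σ k y + 1)
  have hGm : ∀ k, Measurable (G k) := fun k =>
    (Real.measurable_exp.comp hm).mul (((hsm.mul (Real.measurable_log.comp (hσm k))).sub
      (hσm k)).add measurable_const)
  have hG0 : ∀ k y, 0 ≤ G k y := fun k y =>
    mul_nonneg (Real.exp_pos _).le (by
      linarith [Real.neg_one_le_mul_log_clamp_sub (s := s y) (hk1 k)])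
  have hGeq : ∀ k y, G k y = r y * Real.log (σ k y) - Real.exp (Real.log (σ k y) + h y)
      + Real.exp (h y) := fun k y => by
    rw [Real.exp_add, Real.exp_log (hσ0 k y), ← hes y]
    simp only [G]; ring
  have hlogm : ∀ k, Measurable fun y => Real.log (σ k y) := fun k =>
    Real.measurable_log.comp (hσm k)
  have hlogb : ∀ k y, |Real.log (σ k y)| ≤ Real.log (k + 1) := fun k y =>
    Real.abs_log_clamp_le _ (hk1 k)
  have hli : ∀ k, Integrable (fun y => Real.log (σ k y)) ν := fun k =>
    Integrable.of_bound (hlogm k).aestronglyMeasurable _ (Eventually.of_forall (hlogb k))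
  have hei : ∀ k, Integrable (fun y => Real.exp (Real.log (σ k y) + h y)) m := fun k => by
    refine (he.const_mul ((k : ℝ) + 1)).mono'
      (Real.measurable_exp.comp ((hlogm k).add hm)).aestronglyMeasurable
      (Eventually.of_forall fun y => ?_)
    rw [Real.exp_add, Real.exp_log (hσ0 k y), Real.norm_of_nonneg (by
      have := hσ0 k y; positivity)]
    gcongr
    exact hσ1 k y
  set B : ℝ := E - 1 - ∫ y, h y ∂ν + ∫ y, Real.exp (h y) ∂m with hB
  have hGi : ∀ k, Integrable (G k) m := fun k => by
    have h1 := integrable_rnDeriv_mul hac (hli k)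
    exact ((h1.sub (hei k)).add he).congr (Eventually.of_forall fun y => (hGeq k y).symm)
  have hGle : ∀ k, ∫ y, G k y ∂m ≤ B := fun k => by
    have h1 := integrable_rnDeriv_mul hac (hli k)
    have h12 : Integrable (fun y => r y * Real.log (σ k y)
      - Real.exp (Real.log (σ k y) + h y)) m := h1.sub (hei k)
    have e : ∫ y, G k y ∂m = ∫ y, Real.log (σ k y) ∂ν
        - ∫ y, Real.exp (Real.log (σ k y) + h y) ∂m + ∫ y, Real.exp (h y) ∂m := by
      rw [← integral_rnDeriv_mul hac, ← integral_sub h1 (hei k), ← integral_add h12 he]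
      exact integral_congr_ae (Eventually.of_forall fun y => hGeq k y)
    have := hbdd (hlogm k) (hlogb k)
    rw [e]; linarith
  let G' : Y → ℝ := fun y => Real.exp (h y) * (s y * Real.log (s y) - s y + 1)
  have hGt : ∀ y, Tendsto (fun k => G k y) atTop (𝓝 (G' y)) := fun y =>
    ((tendsto_mul_log_clamp_sub (hs0 y)).add_const 1).const_mul _
  have hG'0 : ∀ y, 0 ≤ G' y := fun y => ge_of_tendsto' (hGt y) fun k => hG0 k y
  have hG'm : Measurable G' := (Real.measurable_exp.comp hm).mul
    (((hsm.mul (Real.measurable_log.comp hsm)).sub hsm).add measurable_const)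
  -- Fatou's lemma lets the clamp tend to infinity.
  have hF : ∫⁻ y, ENNReal.ofReal (G' y) ∂m ≤ ENNReal.ofReal B := by
    have h1 := lintegral_liminf_le (μ := m) (u := atTop) fun k => (hGm k).ennreal_ofReal
    have h2 : ∀ y, liminf (fun k => ENNReal.ofReal (G k y)) atTop = ENNReal.ofReal (G' y) :=
      fun y => (ENNReal.tendsto_ofReal (hGt y)).liminf_eq
    simp_rw [h2] at h1
    refine h1.trans (liminf_le_of_le (by isBoundedDefault) fun b hb => ?_)
    obtain ⟨k, hk⟩ := hb.exists
    refine hk.trans ?_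
    rw [← ofReal_integral_eq_lintegral_ofReal (hGi k) (Eventually.of_forall (hG0 k))]
    exact ENNReal.ofReal_le_ofReal (hGle k)
  have hG'i : Integrable G' m := by
    refine ⟨hG'm.aestronglyMeasurable, ?_⟩
    refine lt_of_le_of_lt (lintegral_mono fun y => ?_) (hF.trans_lt ENNReal.ofReal_lt_top)
    rw [Real.enorm_eq_ofReal (hG'0 y)]
  have hB0 : 0 ≤ B := (integral_nonneg (hG0 0)).trans (hGle 0)
  have hG'le : ∫ y, G' y ∂m ≤ B := by
    rw [← ofReal_integral_eq_lintegral_ofReal hG'i (Eventually.of_forall hG'0)] at hF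
    exact (ENNReal.ofReal_le_ofReal_iff hB0).1 hF
  have hrh := integrable_rnDeriv_mul hac hi
  have hφeq : ∀ y, entropyDensity m ν y = G' y + r y * h y + r y - Real.exp (h y) := fun y => by
    have hs : s y = r y * Real.exp (-h y) := rfl
    change r y * Real.log (r y) = Real.exp (h y) * (s y * Real.log (s y) - s y + 1) + _ + _ - _
    have e1 : Real.exp (h y) * (s y * Real.log (s y) - s y + 1)
      = r y * Real.log (s y) - r y + Real.exp (h y) := by
        rw [← hes y]; ring
    rw [e1]
    rcases (hr0 y).eq_or_lt with h0 | h0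
    · rw [← h0]; ring
    · rw [hs, Real.log_mul h0.ne' (Real.exp_pos _).ne', Real.log_exp]; ring
  have i1 : Integrable (fun y => G' y + r y * h y) m := hG'i.add hrh
  have i2 : Integrable (fun y => G' y + r y * h y + r y) m := i1.add hri
  have hφ : Integrable (entropyDensity m ν) m :=
    (i2.sub he).congr (Eventually.of_forall fun y => (hφeq y).symm)
  rw [Ent_eq_integral hac hφ, EReal.coe_le_coe_iff]
  have : ∫ y, entropyDensity m ν y ∂m
      = ∫ y, G' y ∂m + ∫ y, h y ∂ν + 1 - ∫ y, Real.exp (h y) ∂m := by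
    rw [← integral_rnDeriv_mul hac h, ← integral_rnDeriv_eq_one hac, ← integral_add hG'i hrh,
      ← integral_add i1 hri, ← integral_sub i2 he]
    exact integral_congr_ae (Eventually.of_forall hφeq)
  rw [this]
  linarith

end Variational

/-! ### Lifting transport plans along kernels -/

section Lift

variable {X : Type*} [MetricSpace X] [MeasurableSpace X] [BorelSpace X]
  [SecondCountableTopology X] [CompleteSpace X]

/-- A probability measure as an element of the space of probability measures. -/
def asProbabilityMeasure {X : Type*} [MeasurableSpace X] (μ : Measure X)
    [h : IsProbabilityMeasure μ] : ProbabilityMeasure X :=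
  ⟨μ, h⟩

@[simp]
theorem coe_asProbabilityMeasure {X : Type*} [MeasurableSpace X] (μ : Measure X)
    [IsProbabilityMeasure μ] : (asProbabilityMeasure μ : Measure X) = μ :=
  rfl

/-- Integrate the Lipschitz estimate against an optimal plan and use Cauchy–Schwarz to pass from the
`L¹` to the `L²` cost. -/
theorem abs_integral_sub_le_W2 {μ ν : Measure X} [IsProbabilityMeasure μ] [IsProbabilityMeasure ν]
    (hW : W2 μ ν ≠ ∞) {f : X → ℝ} {L : ℝ≥0} (hf : LipschitzWith L f)
    (hμ : Integrable f μ) (hν : Integrable f ν) :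
    |∫ x, f x ∂μ - ∫ x, f x ∂ν| ≤ L * (W2 μ ν).toReal := by
  obtain ⟨π, hπ, hc⟩ := exists_optimal_plan μ ν
  have := isProbabilityMeasure_of_mem_transportPlans hπ
  have hfm : Measurable f := hf.continuous.measurable
  have e1 : ∫ x, f x ∂μ = ∫ z, f z.1 ∂π := by
    rw [← hπ.1, integral_map measurable_fst.aemeasurable hfm.aestronglyMeasurable]
  have e2 : ∫ x, f x ∂ν = ∫ z, f z.2 ∂π := by
    rw [← hπ.2, integral_map measurable_snd.aemeasurable hfm.aestronglyMeasurable]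
  have i1 : Integrable (fun z : X × X => f z.1) π := by
    rw [← hπ.1] at hμ; exact hμ.comp_measurable measurable_fst
  have i2 : Integrable (fun z : X × X => f z.2) π := by
    rw [← hπ.2] at hν; exact hν.comp_measurable measurable_snd
  have hCS : ∫⁻ z, edist z.1 z.2 ∂π ≤ W2 μ ν := by
    have h := ENNReal.lintegral_mul_le_Lp_mul_Lq π Real.HolderConjugate.two_two
      (f := fun z : X × X => edist z.1 z.2) (g := fun _ => 1) (by fun_prop) (by fun_prop)
    simp only [Pi.mul_apply, mul_one, ENNReal.rpow_ofNat, one_pow, lintegral_one,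
      measure_univ, ENNReal.one_rpow] at h
    refine h.trans (le_of_eq ?_)
    change transportCost π ^ (1 / 2 : ℝ) = _
    rw [hc, ← ENNReal.rpow_natCast, ← ENNReal.rpow_mul]; norm_num
  rw [e1, e2, ← integral_sub i1 i2]
  have hle : ‖∫ z, (f z.1 - f z.2) ∂π‖ₑ ≤ L * W2 μ ν := by
    refine (enorm_integral_le_lintegral_enorm _).trans ?_
    calc ∫⁻ z, ‖f z.1 - f z.2‖ₑ ∂π ≤ ∫⁻ z, L * edist z.1 z.2 ∂π := lintegral_mono fun z => by
          rw [← edist_eq_enorm_sub]; exact hf z.1 z.2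
      _ = L * ∫⁻ z, edist z.1 z.2 ∂π := lintegral_const_mul _ (by fun_prop)
      _ ≤ _ := by gcongr
  have := ENNReal.toReal_mono (ENNReal.mul_ne_top ENNReal.coe_ne_top hW) hle
  simpa using this

theorem isTightMeasureSet_range_of_tendsto {μ : ℕ → ProbabilityMeasure X}
    {μ' : ProbabilityMeasure X} (h : Tendsto μ atTop (𝓝 μ')) :
    IsTightMeasureSet (range fun n => (μ n : Measure X)) := by
  have hc : IsCompact (closure (range μ)) :=
    h.isCompact_insert_range.closure_of_subset (subset_insert _ _)
  refine (isTightMeasureSet_of_isCompact_closure hc).subset ?_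
  rintro _ ⟨n, rfl⟩
  exact ⟨μ n, mem_range_self n, rfl⟩

variable {Y : Type*} [MetricSpace Y] [MeasurableSpace Y] [BorelSpace Y]
  [SecondCountableTopology Y] [CompleteSpace Y]

theorem integral_bind_kernel {α β : Type*} [MeasurableSpace α] [MeasurableSpace β]
    {κ : Kernel α β} {μ : Measure α} [SFinite μ] [IsSFiniteKernel κ] {f : β → ℝ}
    (hf : Integrable f (κ ∘ₘ μ)) : ∫ y, f y ∂(κ ∘ₘ μ) = ∫ x, ∫ y, f y ∂κ x ∂μ := by
  rw [Measure.comp_eq_comp_const_apply] at hf ⊢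
  rw [Kernel.integral_comp hf, Kernel.const_apply]

/-- If `κ` is a Markov kernel, `W2`-continuous along the maps `T n → id`, then the mixtures
of `κ ∘ T n` converge weakly to the mixture of `κ`. -/
theorem tendsto_bind_comap {κ : Kernel Y X} [IsMarkovKernel κ] {ν : Measure Y}
    [IsProbabilityMeasure ν] (T : ℕ → SimpleFunc Y Y)
    (hT : ∀ᵐ y ∂ν, Tendsto (fun n => W2 (κ (T n y)) (κ y)) atTop (𝓝 0)) :
    Tendsto (fun n => asProbabilityMeasure ((κ.comap (T n) (T n).measurable) ∘ₘ ν)) atTop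
      (𝓝 (asProbabilityMeasure (κ ∘ₘ ν))) := by
  rw [tendsto_iff_forall_lipschitz_integral_tendsto]
  rintro f ⟨C, hC⟩ ⟨L, hL⟩
  have hfm : Measurable f := hL.continuous.measurable
  obtain ⟨M, hM⟩ : ∃ M, ∀ x, ‖f x‖ ≤ M := by
    rcases isEmpty_or_nonempty X with hX | ⟨⟨x₀⟩⟩
    · exact ⟨0, fun x => (hX.false x).elim⟩
    · refine ⟨C + ‖f x₀‖, fun x => ?_⟩
      have h1 := hC x x₀
      rw [dist_eq_norm] at h1
      linarith [norm_le_norm_add_norm_sub' (f x) (f x₀)]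
  have hfi : ∀ (ρ : Measure X) [IsFiniteMeasure ρ], Integrable f ρ := fun ρ _ =>
    Integrable.of_bound hfm.aestronglyMeasurable M (Eventually.of_forall hM)
  simp only [coe_asProbabilityMeasure]
  rw [integral_bind_kernel (hfi _)]
  simp_rw [fun n => integral_bind_kernel (κ := κ.comap (T n) (T n).measurable) (μ := ν) (hfi _)]
  have hsm : StronglyMeasurable fun y => ∫ x, f x ∂κ y :=
    hfm.stronglyMeasurable.integral_kernel
  refine tendsto_integral_of_dominated_convergence (fun _ => M)
    (fun n => ?_) (integrable_const M) (fun n => Eventually.of_forall fun y => ?_) ?_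
  · simp only [Kernel.comap_apply]
    exact (hsm.comp_measurable (T n).measurable).aestronglyMeasurable
  · refine (norm_integral_le_of_norm_le_const (Eventually.of_forall hM)).trans ?_
    simp
  · filter_upwards [hT] with y hy
    simp only [Kernel.comap_apply]
    rw [tendsto_iff_dist_tendsto_zero]
    have hlim : Tendsto (fun n => (L : ℝ) * (W2 (κ (T n y)) (κ y)).toReal) atTop (𝓝 0) := by
      simpa using ((ENNReal.tendsto_toReal ENNReal.zero_ne_top).comp hy).const_mul (L : ℝ)
    refine squeeze_zero' (Eventually.of_forall fun n => dist_nonneg) ?_ hlim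
    filter_upwards [hy.eventually_lt_const (show (0 : ℝ≥0∞) < ∞ by simp)] with n hn
    exact abs_integral_sub_le_W2 hn.ne hL (hfi _) (hfi _)

/-- If the Markov kernel `κ` is `1`-Lipschitz for `W2` on a set of full measure, then so is
the map `ν ↦ κ ∘ₘ ν` on measures concentrated on this set. -/
theorem exists_plan_bind_le {κ : Kernel Y X} [IsMarkovKernel κ] {Ω : Set Y}
    (hW : ∀ y ∈ Ω, ∀ y' ∈ Ω, W2 (κ y) (κ y') ≤ edist y y') {ν₀ ν₁ : Measure Y}
    (h₀ : ν₀ ∈ P2 Y) (h₁ : ν₁ ∈ P2 Y) (hΩ₀ : ∀ᵐ y ∂ν₀, y ∈ Ω) (hΩ₁ : ∀ᵐ y ∂ν₁, y ∈ Ω) :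
    ∃ π ∈ transportPlans (κ ∘ₘ ν₀) (κ ∘ₘ ν₁), transportCost π ≤ W2 ν₀ ν₁ ^ 2 := by
  have := h₀.1
  have := h₁.1
  obtain ⟨y₀, hy₀⟩ := hΩ₀.exists
  obtain ⟨ρ, hρ, hcost⟩ := exists_optimal_plan ν₀ ν₁
  have := isProbabilityMeasure_of_mem_transportPlans hρ
  -- Choosing optimal plans between `κ y` and `κ y'` measurably in `(y, y')` would need a selection
  -- theorem. Along simple maps with values in `Ω` any choice is measurable; the price is a limit at
  -- the end.
  let T : ℕ → SimpleFunc Y Y := SimpleFunc.approxOn id measurable_id Ω y₀ hy₀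
  have hTΩ : ∀ n y, T n y ∈ Ω := fun n y => SimpleFunc.approxOn_mem measurable_id hy₀ n y
  have hTlim : ∀ y ∈ Ω, Tendsto (fun n => T n y) atTop (𝓝 y) := fun y hy =>
    SimpleFunc.tendsto_approxOn measurable_id hy₀ (subset_closure hy)
  have hTκ : ∀ y ∈ Ω, Tendsto (fun n => W2 (κ (T n y)) (κ y)) atTop (𝓝 0) := fun y hy =>
    tendsto_of_tendsto_of_tendsto_of_le_of_le tendsto_const_nhds
      (tendsto_iff_edist_tendsto_0.1 (hTlim y hy)) (fun n => zero_le)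
      fun n => hW _ (hTΩ n y) _ hy
  choose γ hγ hγc using fun y y' => exists_optimal_plan (κ y) (κ y')
  let S : ℕ → SimpleFunc (Y × Y) (Y × Y) := fun n =>
    ((T n).comp Prod.fst measurable_fst).pair ((T n).comp Prod.snd measurable_snd)
  let Γ : ℕ → Kernel (Y × Y) (X × X) := fun n =>
    ⟨fun z => γ (S n z).1 (S n z).2, ((S n).map fun q : Y × Y => γ q.1 q.2).measurable⟩
  have hΓ : ∀ n z, Γ n z = γ (T n z.1) (T n z.2) := fun n z => rfl
  have hplan : ∀ n, Γ n ∘ₘ ρ ∈ transportPlans ((κ.comap (T n) (T n).measurable) ∘ₘ ν₀)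
      ((κ.comap (T n) (T n).measurable) ∘ₘ ν₁) := fun n => by
    constructor
    · ext s hs
      have hm : Measurable fun y => (κ.comap (T n) (T n).measurable) y s :=
        Kernel.measurable_coe _ hs
      rw [Measure.map_apply measurable_fst hs, Measure.bind_apply (measurable_fst hs)
        (Kernel.aemeasurable _), Measure.bind_apply hs (Kernel.aemeasurable _),
        ← lintegral_comp_fst hρ hm]
      refine lintegral_congr fun z => ?_
      rw [hΓ, ← Measure.map_apply measurable_fst hs, (hγ _ _).1, Kernel.comap_apply]
    · ext s hs
      have hm : Measurable fun y => (κ.comap (T n) (T n).measurable) y s :=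
        Kernel.measurable_coe _ hs
      rw [Measure.map_apply measurable_snd hs, Measure.bind_apply (measurable_snd hs)
        (Kernel.aemeasurable _), Measure.bind_apply hs (Kernel.aemeasurable _),
        ← lintegral_comp_snd hρ hm]
      refine lintegral_congr fun z => ?_
      rw [hΓ, ← Measure.map_apply measurable_snd hs, (hγ _ _).2, Kernel.comap_apply]
  have hcΓ : ∀ n, transportCost (Γ n ∘ₘ ρ) ≤ ∫⁻ z, edist (T n z.1) (T n z.2) ^ 2 ∂ρ := fun n => by
    unfold transportCost
    rw [Measure.lintegral_bind (Kernel.aemeasurable _) measurable_edist_sq.aemeasurable]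
    refine lintegral_mono fun z => ?_
    change transportCost (Γ n z) ≤ _
    rw [hΓ, hγc]
    gcongr
    exact hW _ (hTΩ n _) _ (hTΩ n _)
  have hΩρ : ∀ᵐ z ∂ρ, z.1 ∈ Ω ∧ z.2 ∈ Ω := by
    rw [← hρ.1] at hΩ₀
    rw [← hρ.2] at hΩ₁
    exact (ae_of_ae_map measurable_fst.aemeasurable hΩ₀).and
      (ae_of_ae_map measurable_snd.aemeasurable hΩ₁)
  have hdm : Measurable fun y : Y => edist y y₀ ^ 2 := by fun_prop
  -- Dominated convergence: `approxOn` at most doubles the distance to `y₀`, which yields the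
  -- integrable bound with constant `2 * 2² = 8`.
  have hlim : Tendsto (fun n => ∫⁻ z, edist (T n z.1) (T n z.2) ^ 2 ∂ρ) atTop
      (𝓝 (W2 ν₀ ν₁ ^ 2)) := by
    rw [← hcost]
    refine tendsto_lintegral_of_dominated_convergence
      (fun z => 8 * edist z.1 y₀ ^ 2 + 8 * edist z.2 y₀ ^ 2)
      (fun n => ?_) (fun n => Eventually.of_forall fun z => ?_) ?_ ?_
    · exact measurable_edist_sq.comp (S n).measurable
    · have hT0 : ∀ y, edist (T n y) y₀ ≤ 2 * edist y y₀ := fun y => by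
        have := SimpleFunc.edist_approxOn_y0_le (measurable_id (α := Y)) hy₀ y n
        rw [edist_comm, two_mul, edist_comm y]
        exact this
      calc edist (T n z.1) (T n z.2) ^ 2
          ≤ 2 * edist (T n z.1) y₀ ^ 2 + 2 * edist (T n z.2) y₀ ^ 2 := by
            rw [edist_comm (T n z.2) y₀]; exact edist_sq_le_add
        _ ≤ 2 * (2 * edist z.1 y₀) ^ 2 + 2 * (2 * edist z.2 y₀) ^ 2 := by
            gcongr
            · exact hT0 _
            · exact hT0 _
        _ = _ := by ring
    · rw [lintegral_add_left (by fun_prop), lintegral_const_mul _ (by fun_prop),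
        lintegral_const_mul _ (by fun_prop), lintegral_comp_fst hρ hdm, lintegral_comp_snd hρ hdm]
      exact (ENNReal.add_lt_top.2 ⟨ENNReal.mul_lt_top (by simp) (lintegral_edist_sq_lt_top h₀ y₀),
        ENNReal.mul_lt_top (by simp) (lintegral_edist_sq_lt_top h₁ y₀)⟩).ne
    · filter_upwards [hΩρ] with z hz
      exact ENNReal.Tendsto.pow ((hTlim _ hz.1).edist (hTlim _ hz.2))
  have t0 := tendsto_bind_comap (κ := κ) (ν := ν₀) T (by filter_upwards [hΩ₀] with y hy using hTκ y hy)
  have t1 := tendsto_bind_comap (κ := κ) (ν := ν₁) T (by filter_upwards [hΩ₁] with y hy using hTκ y hy)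
  exact exists_plan_of_tendsto (hyperfilter ℕ) (isTightMeasureSet_range_of_tendsto t0)
    (isTightMeasureSet_range_of_tendsto t1) (t0.mono_left Nat.hyperfilter_le_atTop)
    (t1.mono_left Nat.hyperfilter_le_atTop) hplan (hlim.mono_left Nat.hyperfilter_le_atTop)
    (Eventually.of_forall hcΓ)

end Lift

/-! ### The density of a lifted measure -/

namespace MetricFoliation

/-- Almost every `κ y` lives on the leaf over `y`, where the function `ρ ∘ p` is constant equal to
`ρ y`; it therefore comes out of the inner integral of the disintegration formula. -/
theorem bind_eq_withDensity {X : Type*} [MetricSpace X] [MeasurableSpace X] [BorelSpace X]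
    {F : MetricFoliation X} {m : Measure X} {κ : Kernel F.LeafSpace X}
    (hκ : F.IsDisintegration m κ) [SigmaFinite (F.quotientMeasure m)] {ν : Measure F.LeafSpace}
    [IsProbabilityMeasure ν] (hac : ν ≪ F.quotientMeasure m) :
    κ ∘ₘ ν = m.withDensity fun x => ν.rnDeriv (F.quotientMeasure m) (F.proj x) := by
  have hp : Measurable F.proj := F.continuous_proj.measurable
  have hr := ν.measurable_rnDeriv (F.quotientMeasure m)
  have hrp : Measurable fun x => ν.rnDeriv (F.quotientMeasure m) (F.proj x) := hr.comp hp
  ext s hs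
  rw [withDensity_apply _ hs, ← lintegral_indicator hs, hκ.lintegral_eq _ (hrp.indicator hs),
    Measure.bind_apply hs (Kernel.aemeasurable _)]
  conv_lhs => rw [← Measure.withDensity_rnDeriv_eq _ _ hac]
  rw [lintegral_withDensity_eq_lintegral_mul _ hr (Kernel.measurable_coe _ hs)]
  refine lintegral_congr_ae ?_
  filter_upwards [hκ.concentrated] with y hy
  have hy' : ∀ᵐ x ∂κ y, x ∈ F.proj ⁻¹' {y} := mem_ae_iff.2 hy
  rw [Measure.restrict_eq_self_of_ae_mem hy', Pi.mul_apply, lintegral_indicator hs]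
  have : ∫⁻ x in s, ν.rnDeriv (F.quotientMeasure m) (F.proj x) ∂κ y
      = ∫⁻ _ in s, ν.rnDeriv (F.quotientMeasure m) y ∂κ y := by
    refine lintegral_congr_ae (ae_restrict_of_ae ?_)
    filter_upwards [hy'] with x hx
    rw [show F.proj x = y from hx]
  rw [this]
  simp

end MetricFoliation

/-! ### Limits of curves of measures -/

section Limit

variable {Y : Type*} [MetricSpace Y] [MeasurableSpace Y] [BorelSpace Y]
  [SecondCountableTopology Y] [CompleteSpace Y]

theorem ofReal_dist_sq (x y : Y) : ENNReal.ofReal (dist x y ^ 2) = edist x y ^ 2 := by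
  rw [ENNReal.ofReal_pow dist_nonneg, edist_dist]

theorem integral_dist_sq (μ : Measure Y) (o : Y) :
    ∫ y, dist y o ^ 2 ∂μ = (∫⁻ y, edist y o ^ 2 ∂μ).toReal := by
  rw [integral_eq_lintegral_of_nonneg_ae (Eventually.of_forall fun y => by positivity)
    (by fun_prop)]
  simp_rw [ofReal_dist_sq]

theorem integrable_dist_sq {μ : Measure Y} {o : Y} (h : ∫⁻ y, edist y o ^ 2 ∂μ < ∞) :
    Integrable (fun y => dist y o ^ 2) μ := by
  refine ⟨by fun_prop, ?_⟩
  refine (lintegral_mono fun y => ?_).trans_lt h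
  rw [Real.enorm_eq_ofReal (by positivity), ofReal_dist_sq]

theorem exists_tendsto_of_isTightMeasureSet {ι : Type*} (U : Ultrafilter ι)
    {μ : ι → ProbabilityMeasure Y} (h : IsTightMeasureSet (range fun i => (μ i : Measure Y))) :
    ∃ μ', Tendsto μ U (𝓝 μ') := by
  have ht : IsTightMeasureSet {x | ∃ ρ ∈ range μ, (ρ : Measure Y) = x} := by
    refine h.subset ?_
    rintro _ ⟨_, ⟨i, rfl⟩, rfl⟩
    exact ⟨i, rfl⟩
  obtain ⟨ρ, -, hρ⟩ := (isCompact_closure_of_isTightMeasureSet ht).ultrafilter_le_nhds' (U.map μ)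
    (Ultrafilter.mem_map.2 (Filter.mem_of_superset univ_mem fun i _ =>
      subset_closure (mem_range_self i)))
  exact ⟨ρ, hρ⟩

/-- Uniform integrability in dual form: the hypothesis says that sets of small `n`-measure are
uniformly small for `S`, and the single finite measure `n` is tight. -/
theorem isTightMeasureSet_of_exp_bound {n : Measure Y} [IsFiniteMeasure n] {S : Set (Measure Y)}
    {B : ℝ} (hB : 0 ≤ B) (hfin : ∀ ν ∈ S, IsFiniteMeasure ν)
    (h : ∀ ν ∈ S, ∀ A, MeasurableSet A → ∀ N : ℝ, 0 ≤ N →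
      N * ν.real A ≤ B + Real.exp N * n.real A) :
    IsTightMeasureSet S := by
  rw [isTightMeasureSet_iff_exists_isCompact_measure_compl_le]
  intro ε hε
  obtain ⟨ε', hε', hle⟩ : ∃ ε' : ℝ, 0 < ε' ∧ ENNReal.ofReal ε' ≤ ε := by
    obtain ⟨r, hr0, hr⟩ := ENNReal.lt_iff_exists_nnreal_btwn.1 hε
    exact ⟨r, by exact_mod_cast hr0, by simpa using hr.le⟩
  -- With a compact set whose complement has `n`-measure at most `exp (-N)`, the bound becomes `N
  -- ν(Kᶜ) ≤ B + 1`.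
  set N : ℝ := 2 * (B + 1) / ε' with hN
  have hN0 : 0 < N := by positivity
  obtain ⟨K, hK, hKn⟩ := isTightMeasureSet_iff_exists_isCompact_measure_compl_le.1
    (isTightMeasureSet_singleton (μ := n)) (ENNReal.ofReal (Real.exp (-N)))
    (ENNReal.ofReal_pos.2 (Real.exp_pos _))
  refine ⟨K, hK, fun ν hν => ?_⟩
  have := hfin ν hν
  have h1 := h ν hν Kᶜ hK.isClosed.measurableSet.compl N hN0.le
  have h2 : n.real Kᶜ ≤ Real.exp (-N) :=
    ENNReal.toReal_le_of_le_ofReal (Real.exp_pos _).le (hKn n rfl)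
  have h3 : Real.exp N * n.real Kᶜ ≤ 1 := by
    calc Real.exp N * n.real Kᶜ ≤ Real.exp N * Real.exp (-N) := by gcongr
      _ = 1 := by rw [← Real.exp_add]; simp
  have h4 : ν.real Kᶜ ≤ ε' := by
    have h5 : N * ν.real Kᶜ ≤ B + 1 := by linarith
    rw [hN, div_mul_eq_mul_div, div_le_iff₀ hε'] at h5
    have : 0 ≤ (B + 1) * ε' := by positivity
    nlinarith
  refine le_trans ?_ hle
  rw [← ofReal_measureReal]
  exact ENNReal.ofReal_le_ofReal h4

/-- Second moments pass to the limit along curves of almost intermediate points. -/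
theorem eventually_lintegral_edist_sq_le {ι : Type*} {U : Filter ι} {ν₀ ν₁ : Measure Y} {o : Y}
    (h₀ : ∫⁻ y, edist y o ^ 2 ∂ν₀ < ∞) (h₁ : ∫⁻ y, edist y o ^ 2 ∂ν₁ < ∞)
    {α ν β : ι → ProbabilityMeasure Y} {ν' : ProbabilityMeasure Y}
    (hα : ∀ i, (α i : Measure Y) ≤ (2 : ℝ≥0∞) • ν₀) (hβ : ∀ i, (β i : Measure Y) ≤ (2 : ℝ≥0∞) • ν₁)
    (hν : Tendsto ν U (𝓝 ν')) {t : ℝ} (ht : t ∈ Ioo (0 : ℝ) 1) {D : ι → ℝ≥0∞}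
    (hD : ∀ i, D i ≠ ∞)
    (hl : ∀ i, W2 (α i : Measure Y) (ν i) ^ 2 ≤ ENNReal.ofReal t ^ 2 * D i)
    (hr : ∀ i, W2 (ν i : Measure Y) (β i) ^ 2 ≤ ENNReal.ofReal (1 - t) ^ 2 * D i)
    (hlim : Tendsto (fun i => D i - W2 (α i : Measure Y) (β i) ^ 2) U (𝓝 0))
    {ε : ℝ≥0∞} (hε : 0 < ε) :
    ∀ᶠ i in U, ∫⁻ y, edist y o ^ 2 ∂(ν i : Measure Y)
      ≤ ∫⁻ y, edist y o ^ 2 ∂(ν' : Measure Y) + ε := by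
  rcases eq_or_ne (∫⁻ y, edist y o ^ 2 ∂(ν' : Measure Y)) ∞ with htop | htop
  · simp [htop]
  -- The factor `2` absorbs the domination of `α i`, `β i` by `2 ν₀`, `2 ν₁`. Of the four quarters
  -- of `ε`, two go to these tails, one to the defect from minimality and one to the truncated
  -- moment.
  have htail : ∀ (a : ℝ≥0∞) (_ : a ≠ ∞) {μ : Measure Y}, ∫⁻ y, edist y o ^ 2 ∂μ < ∞ →
      Tendsto (fun M : ℕ => 2 * ∫⁻ y, (a * edist y o ^ 2 - (M : ℝ≥0∞) / 2) ∂μ) atTop (𝓝 0) := by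
    intro a ha μ hμ
    have h1 : Tendsto (fun M : ℕ => ∫⁻ y, (a * edist y o ^ 2 - (M : ℝ≥0∞) / 2) ∂μ) atTop
        (𝓝 (∫⁻ _, 0 ∂μ)) := by
      refine tendsto_lintegral_of_dominated_convergence (fun y => a * edist y o ^ 2)
        (fun M => by fun_prop) (fun M => Eventually.of_forall fun y => tsub_le_self) ?_ ?_
      · rw [lintegral_const_mul _ (by fun_prop)]
        exact ENNReal.mul_ne_top ha hμ.ne
      · refine Eventually.of_forall fun y => tendsto_const_nhds.congr' ?_
        have hfin : 2 * (a * edist y o ^ 2) ≠ ∞ :=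
          ENNReal.mul_ne_top (by simp) (ENNReal.mul_ne_top ha (ENNReal.pow_ne_top (edist_ne_top _ _)))
        obtain ⟨M₀, hM₀⟩ := ENNReal.exists_nat_gt hfin
        filter_upwards [eventually_ge_atTop M₀] with M hM
        refine (tsub_eq_zero_of_le ?_).symm
        rw [ENNReal.le_div_iff_mul_le (by simp) (by simp), mul_comm]
        exact hM₀.le.trans (by exact_mod_cast hM)
    rw [lintegral_zero] at h1
    simpa using ENNReal.Tendsto.const_mul h1 (Or.inr (by simp : (2 : ℝ≥0∞) ≠ ∞))
  have hε4 : 0 < ε / 4 := ENNReal.div_pos hε.ne' (by simp)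
  obtain ⟨M, hM0, hM1⟩ := (((htail 6 (by simp) h₀).eventually_lt_const hε4).and
    ((htail 4 (by simp) h₁).eventually_lt_const hε4)).exists
  have hlim2 : Tendsto (fun i => 2 * (D i - W2 (α i : Measure Y) (β i) ^ 2)) U (𝓝 0) := by
    simpa using ENNReal.Tendsto.const_mul hlim (Or.inr (by simp : (2 : ℝ≥0∞) ≠ ∞))
  have hmin := tendsto_lintegral_min_of_tendsto hν (f := fun y => nndist y o ^ 2) (by fun_prop) M
  simp only [ENNReal.coe_pow, ← edist_nndist, ENNReal.coe_natCast] at hmin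
  have hminle : ∫⁻ y, min (edist y o ^ 2) (M : ℝ≥0∞) ∂(ν' : Measure Y)
      < ∫⁻ y, edist y o ^ 2 ∂(ν' : Measure Y) + ε / 4 :=
    (lintegral_mono fun y => min_le_left _ _).trans_lt (ENNReal.lt_add_right htop hε4.ne')
  filter_upwards [hlim2.eventually_lt_const hε4, hmin.eventually_lt_const hminle] with i hi1 hi2
  have hsplit : ∀ y, edist y o ^ 2 = min (edist y o ^ 2) (M : ℝ≥0∞) + (edist y o ^ 2 - M) :=
    fun y => by
      rcases le_total (edist y o ^ 2) (M : ℝ≥0∞) with h | h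
      · rw [min_eq_left h, tsub_eq_zero_of_le h, add_zero]
      · rw [min_eq_right h, add_tsub_cancel_of_le h]
  have hdom : ∀ {ρ μ : Measure Y} (f : Y → ℝ≥0∞), ρ ≤ (2 : ℝ≥0∞) • μ →
      ∫⁻ y, f y ∂ρ ≤ 2 * ∫⁻ y, f y ∂μ := fun f h => by
    refine (lintegral_mono' h le_rfl).trans ?_
    rw [lintegral_smul_measure, smul_eq_mul]
  calc ∫⁻ y, edist y o ^ 2 ∂(ν i : Measure Y)
      = ∫⁻ y, min (edist y o ^ 2) (M : ℝ≥0∞) ∂(ν i : Measure Y)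
          + ∫⁻ y, (edist y o ^ 2 - M) ∂(ν i : Measure Y) := by
        rw [← lintegral_add_left (by fun_prop)]
        exact lintegral_congr hsplit
    _ ≤ (∫⁻ y, edist y o ^ 2 ∂(ν' : Measure Y) + ε / 4) + (ε / 4 + ε / 4 + ε / 4) := by
        refine add_le_add hi2.le ((lintegral_tail_le ht (hD i) (hl i) (hr i) o M).trans ?_)
        exact add_le_add (add_le_add ((hdom _ (hα i)).trans hM0.le)
          ((hdom _ (hβ i)).trans hM1.le)) hi1.le
    _ = ∫⁻ y, edist y o ^ 2 ∂(ν' : Measure Y) + 4 * (ε / 4) := by ring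
    _ = _ := by rw [ENNReal.mul_div_cancel (by simp) (by simp)]

/-- A curve of probability measures is a minimal geodesic as soon as it does not move faster
than one. -/
theorem isW2Geodesic_of_le {μ : ℝ → Measure Y} (hp : ∀ t, IsProbabilityMeasure (μ t))
    (h₀ : μ 0 ∈ P2 Y) (h₁ : μ 1 ∈ P2 Y)
    (h : ∀ s ∈ Icc (0 : ℝ) 1, ∀ t ∈ Icc (0 : ℝ) 1,
      W2 (μ s) (μ t) ≤ ENNReal.ofReal |s - t| * W2 (μ 0) (μ 1)) : IsW2Geodesic μ := by
  have hfin := W2_lt_top h₀ h₁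
  have z0 : (0 : ℝ) ∈ Icc (0 : ℝ) 1 := ⟨le_rfl, zero_le_one⟩
  have z1 : (1 : ℝ) ∈ Icc (0 : ℝ) 1 := ⟨zero_le_one, le_rfl⟩
  have hlt : ∀ s ∈ Icc (0 : ℝ) 1, ∀ t ∈ Icc (0 : ℝ) 1, W2 (μ s) (μ t) < ∞ := fun s hs t ht =>
    (h s hs t ht).trans_lt (ENNReal.mul_lt_top ENNReal.ofReal_lt_top hfin)
  -- The upper bounds on `[0, s]`, `[s, t]`, `[t, 1]` add up to exactly the distance of the end
  -- points, so the triangle inequality forces equality on each piece.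
  have key : ∀ s ∈ Icc (0 : ℝ) 1, ∀ t ∈ Icc (0 : ℝ) 1, s ≤ t →
      ENNReal.ofReal |s - t| * W2 (μ 0) (μ 1) ≤ W2 (μ s) (μ t) := fun s hs t ht hst => by
    have e1 := h 0 z0 s hs
    have e2 := h t ht 1 z1
    have e3 := (W2_triangle (μ 0) (μ s) (μ 1)).trans
      (add_le_add_right (W2_triangle (μ s) (μ t) (μ 1)) _)
    rw [zero_sub, abs_neg, abs_of_nonneg hs.1] at e1
    rw [abs_sub_comm, abs_of_nonneg (sub_nonneg.2 ht.2)] at e2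
    rw [abs_sub_comm, abs_of_nonneg (sub_nonneg.2 hst)]
    have f1 := (hlt 0 z0 s hs).ne
    have f2 := (hlt s hs t ht).ne
    have f3 := (hlt t ht 1 z1).ne
    lift W2 (μ 0) (μ 1) to ℝ≥0 using hfin.ne with D
    lift W2 (μ 0) (μ s) to ℝ≥0 using f1 with a
    lift W2 (μ s) (μ t) to ℝ≥0 using f2 with b
    lift W2 (μ t) (μ 1) to ℝ≥0 using f3 with c
    rw [ENNReal.ofReal, ← ENNReal.coe_mul, ENNReal.coe_le_coe, ← NNReal.coe_le_coe,
      NNReal.coe_mul, Real.coe_toNNReal _ (by linarith [hs.1, ht.1, hs.2, ht.2])] at e1 e2 ⊢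
    have e4 : (D : ℝ) ≤ a + (b + c) := by exact_mod_cast e3
    linarith
  refine ⟨fun t ht => mem_P2_of_W2_lt_top h₀ (hlt 0 z0 t ht), fun s hs t ht =>
    le_antisymm (h s hs t ht) ?_⟩
  rcases le_total s t with hst | hst
  · exact key s hs t ht hst
  · rw [abs_sub_comm, W2_comm (μ s)]
    exact key t ht s hs hst

end Limit

/-! ### Compactness of asymptotically minimal curves -/

section ApproximateGeodesics

variable {Y : Type*} [MetricSpace Y] [MeasurableSpace Y] [BorelSpace Y]
  [SecondCountableTopology Y] [CompleteSpace Y]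

/-- Turns the functional entropy bound at `b = N · 1_A` into the hypothesis of
`isTightMeasureSet_of_exp_bound`. -/
theorem integral_exp_indicator_add_le {m : Measure Y} {h : Y → ℝ}
    (he : Integrable (fun y => Real.exp (h y)) m) {A : Set Y} (hA : MeasurableSet A) {N : ℝ} :
    ∫ y, Real.exp (A.indicator (fun _ => N) y + h y) ∂m ≤ ∫ y, Real.exp (h y) ∂m
      + Real.exp N * (m.withDensity fun y => ENNReal.ofReal (Real.exp (h y))).real A := by
  have hr : (m.withDensity fun y => ENNReal.ofReal (Real.exp (h y))).real A
      = ∫ y, A.indicator (fun y => Real.exp (h y)) y ∂m := by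
    rw [integral_indicator hA, measureReal_def, withDensity_apply _ hA,
      integral_eq_lintegral_of_nonneg_ae (Eventually.of_forall fun y => (Real.exp_pos _).le)
        he.restrict.aestronglyMeasurable]
  have hi : Integrable (A.indicator fun y => Real.exp (h y)) m := he.indicator hA
  rw [hr, ← integral_const_mul, ← integral_add he (hi.const_mul _)]
  refine integral_mono_of_nonneg (Eventually.of_forall fun y => (Real.exp_pos _).le)
    (he.add (hi.const_mul _)) (Eventually.of_forall fun y => ?_)
  by_cases hy : y ∈ A
  · simp only [indicator_of_mem hy, Real.exp_add]
    linarith [Real.exp_pos (h y)]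
  · simp [indicator_of_notMem hy]

/-- A sequence of curves `ν n` with uniform functional entropy bounds and asymptotically minimal
speed, whose end points are dominated by and converge to `ν₀`, `ν₁`, subconverges to a minimal
geodesic along which the entropy obeys the limit bound. -/
theorem exists_isW2Geodesic_of_approx {m : Measure Y} [SigmaFinite m] {C : ℝ} {o : Y}
    (he : Integrable (fun y => Real.exp (-(C ^ 2 * dist y o ^ 2))) m) {ν₀ ν₁ : Measure Y}
    (h₀ : ν₀ ∈ P2 Y) (h₁ : ν₁ ∈ P2 Y) {ν : ℕ → ℝ → Measure Y}
    [hp : ∀ n t, IsProbabilityMeasure (ν n t)]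
    (hdom₀ : ∀ n, ν n 0 ≤ (2 : ℝ≥0∞) • ν₀) (hdom₁ : ∀ n, ν n 1 ≤ (2 : ℝ≥0∞) • ν₁)
    (hlim₀ : ∀ f : BoundedContinuousFunction Y ℝ,
      Tendsto (fun n => ∫ y, f y ∂ν n 0) atTop (𝓝 (∫ y, f y ∂ν₀)))
    (hlim₁ : ∀ f : BoundedContinuousFunction Y ℝ,
      Tendsto (fun n => ∫ y, f y ∂ν n 1) atTop (𝓝 (∫ y, f y ∂ν₁)))
    {D δ : ℕ → ℝ≥0∞} (hD : Tendsto D atTop (𝓝 (W2 ν₀ ν₁ ^ 2)))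
    (hD2 : ∀ n, D n ≤ 2 * W2 ν₀ ν₁ ^ 2) (hδ : ∀ n, δ n ≤ D n)
    (hgeo : ∀ n, ∀ s ∈ Icc (0 : ℝ) 1, ∀ t ∈ Icc (0 : ℝ) 1,
      W2 (ν n s) (ν n t) ^ 2 ≤ ENNReal.ofReal |s - t| ^ 2 * δ n)
    {K : ℝ} {e₀ e₁ : ℕ → ℝ} {E₀ E₁ : ℝ} (he₀ : Tendsto e₀ atTop (𝓝 E₀))
    (he₁ : Tendsto e₁ atTop (𝓝 E₁))
    (hent : ∀ n, ∀ t ∈ Ioo (0 : ℝ) 1, ∀ b : Y → ℝ, Measurable b → (∃ M, ∀ y, |b y| ≤ M) →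
      ∫ y, b y ∂ν n t + ∫ y, -(C ^ 2 * dist y o ^ 2) ∂ν n t + 1
        - ∫ y, Real.exp (b y + -(C ^ 2 * dist y o ^ 2)) ∂m
      ≤ (1 - t) * e₀ n + t * e₁ n - K / 2 * t * (1 - t) * (δ n).toReal) :
    ∃ μ : ℝ → Measure Y, IsW2Geodesic μ ∧ μ 0 = ν₀ ∧ μ 1 = ν₁ ∧ ∀ t ∈ Ioo (0 : ℝ) 1,
      Ent m (μ t) ≤ (((1 - t) * E₀ + t * E₁
        - K / 2 * t * (1 - t) * (W2 ν₀ ν₁).toReal ^ 2 : ℝ) : EReal) := by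
  have := h₀.1
  have := h₁.1
  have z0 : (0 : ℝ) ∈ Icc (0 : ℝ) 1 := ⟨le_rfl, zero_le_one⟩
  have z1 : (1 : ℝ) ∈ Icc (0 : ℝ) 1 := ⟨zero_le_one, le_rfl⟩
  have hWfin : W2 ν₀ ν₁ ^ 2 ≠ ∞ := ENNReal.pow_ne_top (W2_lt_top h₀ h₁).ne
  have hDfin : ∀ n, D n ≠ ∞ := fun n =>
    ne_top_of_le_ne_top (ENNReal.mul_ne_top (by simp) hWfin) (hD2 n)
  have hδfin : ∀ n, δ n ≠ ∞ := fun n => ne_top_of_le_ne_top (hDfin n) (hδ n)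
  set h : Y → ℝ := fun y => -(C ^ 2 * dist y o ^ 2) with hh
  have hhm : Measurable h := by fun_prop
  have hhi : ∀ μ : Measure Y, ∫ y, h y ∂μ = -(C ^ 2 * (∫⁻ y, edist y o ^ 2 ∂μ).toReal) := fun μ => by
    rw [← integral_dist_sq, ← integral_const_mul, ← integral_neg]
  have hn : IsFiniteMeasure (m.withDensity fun y => ENNReal.ofReal (Real.exp (h y))) :=
    isFiniteMeasure_withDensity_ofReal he.2
  -- second moments are uniformly bounded
  set R : ℝ≥0∞ := 2 * (2 * W2 ν₀ ν₁ ^ 2) + 2 * (2 * ∫⁻ y, edist y o ^ 2 ∂ν₀) with hR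
  have hRfin : R ≠ ∞ := by
    refine ENNReal.add_ne_top.2 ⟨ENNReal.mul_ne_top (by simp) (ENNReal.mul_ne_top (by simp) hWfin),
      ENNReal.mul_ne_top (by simp) (ENNReal.mul_ne_top (by simp)
        (lintegral_edist_sq_lt_top h₀ o).ne)⟩
  have hmom : ∀ n, ∀ t ∈ Icc (0 : ℝ) 1, ∫⁻ y, edist y o ^ 2 ∂ν n t ≤ R := fun n t ht => by
    obtain ⟨π, hπ, hc⟩ := exists_optimal_plan (ν n 0) (ν n t)
    refine (lintegral_edist_sq_le hπ o).trans ?_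
    rw [hc, hR]
    gcongr
    · refine (hgeo n 0 z0 t ht).trans ?_
      have h1 : ENNReal.ofReal |0 - t| ^ 2 ≤ 1 := by
        refine pow_le_one₀ zero_le ?_
        rw [zero_sub, abs_neg, abs_of_nonneg ht.1, ← ENNReal.ofReal_one]
        exact ENNReal.ofReal_le_ofReal ht.2
      calc ENNReal.ofReal |0 - t| ^ 2 * δ n ≤ 1 * D n := mul_le_mul' h1 (hδ n)
        _ ≤ _ := by rw [one_mul]; exact hD2 n
    · refine (lintegral_mono' (hdom₀ n) le_rfl).trans ?_
      rw [lintegral_smul_measure, smul_eq_mul]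
  -- the limit measures
  let P : ℕ → ℝ → ProbabilityMeasure Y := fun n t => asProbabilityMeasure (ν n t)
  have hP₀ : Tendsto (fun n => P n 0) atTop (𝓝 (asProbabilityMeasure ν₀)) :=
    ProbabilityMeasure.tendsto_iff_forall_integral_tendsto.2 hlim₀
  have hP₁ : Tendsto (fun n => P n 1) atTop (𝓝 (asProbabilityMeasure ν₁)) :=
    ProbabilityMeasure.tendsto_iff_forall_integral_tendsto.2 hlim₁
  -- A single ultrafilter provides limits for all the uncountably many times `t` at once, without
  -- extracting subsequences or using equicontinuity.
  let U : Ultrafilter ℕ := hyperfilter ℕ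
  have hU : (U : Filter ℕ) ≤ atTop := Nat.hyperfilter_le_atTop
  obtain ⟨B, hB⟩ : ∃ B : ℝ, ∀ n, ∀ t ∈ Ioo (0 : ℝ) 1,
      (1 - t) * e₀ n + t * e₁ n - K / 2 * t * (1 - t) * (δ n).toReal ≤ B := by
    obtain ⟨B₀, hB₀⟩ := he₀.bddAbove_range
    obtain ⟨B₁, hB₁⟩ := he₁.bddAbove_range
    refine ⟨|B₀| + |B₁| + |K| / 2 * (2 * W2 ν₀ ν₁ ^ 2).toReal, fun n t ht => ?_⟩
    have k0 : e₀ n ≤ |B₀| := (hB₀ (mem_range_self n)).trans (le_abs_self _)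
    have k1 : e₁ n ≤ |B₁| := (hB₁ (mem_range_self n)).trans (le_abs_self _)
    have k2 : (δ n).toReal ≤ (2 * W2 ν₀ ν₁ ^ 2).toReal :=
      ENNReal.toReal_mono (ENNReal.mul_ne_top (by simp) hWfin) ((hδ n).trans (hD2 n))
    have t0 : 0 < t := ht.1
    have t1 : 0 < 1 - t := sub_pos.2 ht.2
    have q0 : (1 - t) * e₀ n ≤ |B₀| := by
      nlinarith [abs_nonneg B₀, mul_le_mul_of_nonneg_left k0 t1.le]
    have q1 : t * e₁ n ≤ |B₁| := by
      nlinarith [abs_nonneg B₁, mul_le_mul_of_nonneg_left k1 t0.le]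
    have q2 : -(K / 2 * t * (1 - t) * (δ n).toReal) ≤ |K| / 2 * (2 * W2 ν₀ ν₁ ^ 2).toReal := by
      have tt : t * (1 - t) ≤ 1 := by nlinarith
      calc -(K / 2 * t * (1 - t) * (δ n).toReal) = (-K / 2) * ((t * (1 - t)) * (δ n).toReal) := by
            ring
        _ ≤ |K| / 2 * ((t * (1 - t)) * (δ n).toReal) := by
            gcongr
            exact neg_le_abs K
        _ ≤ |K| / 2 * (1 * (2 * W2 ν₀ ν₁ ^ 2).toReal) := by gcongr
        _ = _ := by ring
    linarith
  have htight : ∀ t ∈ Ioo (0 : ℝ) 1, IsTightMeasureSet (range fun n => (P n t : Measure Y)) := by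
    intro t ht
    refine isTightMeasureSet_of_exp_bound
      (n := m.withDensity fun y => ENNReal.ofReal (Real.exp (h y)))
      (B := |B| + C ^ 2 * R.toReal + ∫ y, Real.exp (h y) ∂m) ?_ ?_ ?_
    · have : 0 ≤ ∫ y, Real.exp (h y) ∂m := integral_nonneg fun y => (Real.exp_pos _).le
      positivity
    · rintro _ ⟨n, rfl⟩
      infer_instance
    · rintro _ ⟨n, rfl⟩ A hA N hN
      have k1 := (hent n t ht (A.indicator fun _ => N) (measurable_const.indicator hA)
        ⟨N, fun y => by
          by_cases hy : y ∈ A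
          · simp [hy, abs_of_nonneg hN]
          · simp [hy, hN]⟩).trans (hB n t ht)
      have k2 := integral_exp_indicator_add_le he hA (N := N)
      have k3 : (∫⁻ y, edist y o ^ 2 ∂ν n t).toReal ≤ R.toReal :=
        ENNReal.toReal_mono hRfin (hmom n t ⟨ht.1.le, ht.2.le⟩)
      have k4 := hhi (ν n t)
      rw [integral_indicator_const _ hA, smul_eq_mul] at k1
      have k5 := le_abs_self B
      have k6 : C ^ 2 * (∫⁻ y, edist y o ^ 2 ∂ν n t).toReal ≤ C ^ 2 * R.toReal := by gcongr
      change N * (ν n t).real A ≤ _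
      simp only [hh] at k2 k4 ⊢
      linarith
  have hex : ∀ t, ∃ ρ : ProbabilityMeasure Y, t ∈ Icc (0 : ℝ) 1 →
      IsTightMeasureSet (range fun n => (P n t : Measure Y)) ∧
      Tendsto (fun n => P n t) U (𝓝 ρ) ∧ (t = 0 → ρ = asProbabilityMeasure ν₀) ∧
        (t = 1 → ρ = asProbabilityMeasure ν₁) := by
    intro t
    by_cases ht : t ∈ Icc (0 : ℝ) 1
    swap
    · exact ⟨asProbabilityMeasure ν₀, fun h => absurd h ht⟩
    rcases eq_or_ne t 0 with rfl | ht0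
    · exact ⟨_, fun _ => ⟨isTightMeasureSet_range_of_tendsto hP₀, hP₀.mono_left hU, fun _ => rfl,
        fun h => absurd h zero_ne_one⟩⟩
    rcases eq_or_ne t 1 with rfl | ht1
    · exact ⟨_, fun _ => ⟨isTightMeasureSet_range_of_tendsto hP₁, hP₁.mono_left hU,
        fun h => absurd h one_ne_zero, fun _ => rfl⟩⟩
    have ht' : t ∈ Ioo (0 : ℝ) 1 := ⟨lt_of_le_of_ne ht.1 ht0.symm, lt_of_le_of_ne ht.2 ht1⟩
    obtain ⟨ρ, hρ⟩ := exists_tendsto_of_isTightMeasureSet U (htight t ht')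
    exact ⟨ρ, fun _ => ⟨htight t ht', hρ, fun h => absurd h ht0, fun h => absurd h ht1⟩⟩
  choose Q hQ using hex
  have hQ0 : (Q 0 : Measure Y) = ν₀ := by rw [(hQ 0 z0).2.2.1 rfl]; rfl
  have hQ1 : (Q 1 : Measure Y) = ν₁ := by rw [(hQ 1 z1).2.2.2 rfl]; rfl
  have hspeed : ∀ s ∈ Icc (0 : ℝ) 1, ∀ t ∈ Icc (0 : ℝ) 1,
      W2 (Q s : Measure Y) (Q t) ≤ ENNReal.ofReal |s - t| * W2 ν₀ ν₁ := fun s hs t ht => by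
    rw [← ENNReal.pow_le_pow_left_iff two_ne_zero, mul_pow]
    refine W2_sq_le_of_tendsto U (hQ s hs).1 (hQ t ht).1 (hQ s hs).2.1 (hQ t ht).2.1
      (B := fun n => ENNReal.ofReal |s - t| ^ 2 * D n)
      (ENNReal.Tendsto.const_mul (hD.mono_left hU)
        (Or.inr (ENNReal.pow_ne_top ENNReal.ofReal_ne_top)))
      (Eventually.of_forall fun n => (hgeo n s hs t ht).trans ?_)
    gcongr
    exact hδ n
  have hgd : IsW2Geodesic fun t => (Q t : Measure Y) :=
    isW2Geodesic_of_le (fun t => inferInstance) (by rw [hQ0]; exact h₀) (by rw [hQ1]; exact h₁)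
      (by simpa only [hQ0, hQ1] using hspeed)
  refine ⟨fun t => (Q t : Measure Y), hgd, hQ0, hQ1, fun t ht => ?_⟩
  have htI : t ∈ Icc (0 : ℝ) 1 := ⟨ht.1.le, ht.2.le⟩
  -- squared distances of the end points converge
  have hlow : ∀ η : ℕ → ℝ≥0∞, (∀ n, W2 (ν n 0) (ν n 1) ^ 2 ≤ η n) → (∀ n, η n ≤ D n) →
      Tendsto η U (𝓝 (W2 ν₀ ν₁ ^ 2)) := by
    intro η hη1 hη2
    obtain ⟨d, -, hd⟩ := isCompact_univ.ultrafilter_le_nhds' (U.map η) univ_mem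
    have hd' : Tendsto η U (𝓝 d) := hd
    have e1 : d ≤ W2 ν₀ ν₁ ^ 2 :=
      le_of_tendsto_of_tendsto hd' (hD.mono_left hU) (Eventually.of_forall hη2)
    have e2 : W2 ν₀ ν₁ ^ 2 ≤ d :=
      W2_sq_le_of_tendsto U (isTightMeasureSet_range_of_tendsto hP₀)
        (isTightMeasureSet_range_of_tendsto hP₁) (hP₀.mono_left hU) (hP₁.mono_left hU) hd'
        (Eventually.of_forall hη1)
    rwa [le_antisymm e1 e2] at hd'
  have h01 : ∀ n, W2 (ν n 0) (ν n 1) ^ 2 ≤ δ n := fun n => by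
    simpa using hgeo n 0 z0 1 z1
  -- As `K` may have either sign, a one-sided bound on `δ n` would not suffice: actual convergence
  -- is needed in the curvature term.
  have hδlim := hlow δ h01 hδ
  have hηlim := hlow (fun n => W2 (ν n 0) (ν n 1) ^ 2) (fun n => le_rfl)
    fun n => (h01 n).trans (hδ n)
  have hdef : Tendsto (fun n => D n - W2 (ν n 0) (ν n 1) ^ 2) U (𝓝 0) := by
    have := ENNReal.Tendsto.sub (hD.mono_left hU) hηlim (Or.inl hWfin)
    rwa [tsub_self] at this
  have hQ2 : (Q t : Measure Y) ∈ P2 Y := hgd.1 t htI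
  have hQfin := lintegral_edist_sq_lt_top hQ2 o
  have hQi : Integrable h (Q t : Measure Y) := ((integrable_dist_sq hQfin).const_mul _).neg
  have hElim : Tendsto (fun n => (1 - t) * e₀ n + t * e₁ n - K / 2 * t * (1 - t) * (δ n).toReal) U
      (𝓝 ((1 - t) * E₀ + t * E₁ - K / 2 * t * (1 - t) * (W2 ν₀ ν₁).toReal ^ 2)) := by
    rw [← ENNReal.toReal_pow]
    exact ((((he₀.mono_left hU).const_mul _).add ((he₁.mono_left hU).const_mul _))).sub
      (((ENNReal.tendsto_toReal hWfin).comp hδlim).const_mul _)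
  refine Ent_le_of_boundedContinuous hhm hQi he fun b => ?_
  have hb := (ProbabilityMeasure.tendsto_iff_forall_integral_tendsto.1 (hQ t htI).2.1 b)
  refine le_of_forall_pos_le_add fun ε₁ hε₁ => ?_
  -- The error in the second moment enters multiplied by `C ^ 2`; the `+ 1` avoids dividing by zero,
  -- as `C` is arbitrary here.
  obtain ⟨ε, hε, hεε⟩ : ∃ ε : ℝ, 0 < ε ∧ (C ^ 2 + 1) * ε = ε₁ :=
    ⟨ε₁ / (C ^ 2 + 1), by positivity, by field_simp⟩
  -- The moment occurs with a negative sign in the functional, so it must not drop in the limit.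
  -- This is the place where asymptotic minimality of the curves is used.
  have hmomlim := eventually_lintegral_edist_sq_le (U := (U : Filter ℕ)) (o := o)
    (lintegral_edist_sq_lt_top h₀ o) (lintegral_edist_sq_lt_top h₁ o)
    (α := fun n => P n 0) (ν := fun n => P n t) (β := fun n => P n 1) hdom₀ hdom₁
    (hQ t htI).2.1 ht hDfin
    (fun n => (hgeo n 0 z0 t htI).trans (by
      rw [zero_sub, abs_neg, abs_of_pos ht.1]; gcongr; exact hδ n))
    (fun n => (hgeo n t htI 1 z1).trans (by
      rw [abs_sub_comm, abs_of_pos (sub_pos.2 ht.2)]; gcongr; exact hδ n))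
    hdef (ε := ENNReal.ofReal ε) (ENNReal.ofReal_pos.2 hε)
  have hlim : ∫ y, b y ∂(Q t : Measure Y) + ∫ y, h y ∂(Q t : Measure Y) - C ^ 2 * ε + 1
      - ∫ y, Real.exp (b y + h y) ∂m
      ≤ (1 - t) * E₀ + t * E₁ - K / 2 * t * (1 - t) * (W2 ν₀ ν₁).toReal ^ 2 := by
    refine le_of_tendsto_of_tendsto
      ((((hb.add_const (∫ y, h y ∂(Q t : Measure Y))).sub_const (C ^ 2 * ε)).add_const 1).sub_const
        (∫ y, Real.exp (b y + h y) ∂m)) hElim ?_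
    filter_upwards [hmomlim] with n hmn
    refine le_trans ?_ (hent n t ht b b.continuous.measurable
      ⟨‖b‖, fun y => by simpa using b.norm_coe_le_norm y⟩)
    have k1 : (∫⁻ y, edist y o ^ 2 ∂ν n t).toReal
        ≤ (∫⁻ y, edist y o ^ 2 ∂(Q t : Measure Y)).toReal + ε := by
      have := ENNReal.toReal_mono (by
        exact ENNReal.add_ne_top.2 ⟨hQfin.ne, ENNReal.ofReal_ne_top⟩) hmn
      rwa [ENNReal.toReal_add hQfin.ne ENNReal.ofReal_ne_top, ENNReal.toReal_ofReal hε.le] at this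
    have k2 := hhi (ν n t)
    have k3 := hhi (Q t : Measure Y)
    have k4 : C ^ 2 * (∫⁻ y, edist y o ^ 2 ∂ν n t).toReal
        ≤ C ^ 2 * ((∫⁻ y, edist y o ^ 2 ∂(Q t : Measure Y)).toReal + ε) := by gcongr
    change ∫ y, b y ∂ν n t + _ - _ + _ - _ ≤ ∫ y, b y ∂ν n t + ∫ y, h y ∂ν n t + 1
        - ∫ y, Real.exp (b y + h y) ∂m
    rw [k2, k3]
    linarith
  linarith

end ApproximateGeodesics

/-! ### Truncation of transport plans -/

section Truncation

variable {X : Type*} [MetricSpace X] [MeasurableSpace X] [BorelSpace X]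
  [SecondCountableTopology X]

theorem FiniteOnBalls.sigmaFinite {m : Measure X} (h : FiniteOnBalls m) [Nonempty X] :
    SigmaFinite m := by
  obtain ⟨x⟩ := ‹Nonempty X›
  exact ⟨⟨{ set := fun n => Metric.ball x n
            set_mem := fun _ => trivial
            finite := fun n => h x n
            spanning := Metric.iUnion_ball_nat x }⟩⟩

/-- A probability measure on `X × X` is a limit of its normalised restrictions to bounded sets,
whose marginals have finite second moments. -/
theorem exists_truncation (π : Measure (X × X)) [IsProbabilityMeasure π] (x₀ : X) :
    ∃ (c : ℕ → ℝ≥0∞) (π' : ℕ → Measure (X × X)), (∀ n, IsProbabilityMeasure (π' n)) ∧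
      (∀ n, π' n ≤ c n • π) ∧ Tendsto c atTop (𝓝 1) ∧ (∀ n, c n ≤ 2) ∧ (∀ n, c n ≠ 0) ∧
      (∀ n, (π' n).map Prod.fst ∈ P2 X) ∧ (∀ n, (π' n).map Prod.snd ∈ P2 X) ∧
      ∀ f : X × X → ℝ, Integrable f π →
        Tendsto (fun n => ∫ z, f z ∂π' n) atTop (𝓝 (∫ z, f z ∂π)) := by
  let B : ℕ → Set (X × X) := fun n => Metric.ball x₀ n ×ˢ Metric.ball x₀ n
  have hBm : ∀ n, MeasurableSet (B n) := fun n => measurableSet_ball.prod measurableSet_ball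
  have hBmono : Monotone B := fun n k h =>
    prod_mono (Metric.ball_subset_ball (by exact_mod_cast h))
      (Metric.ball_subset_ball (by exact_mod_cast h))
  have hBU : ⋃ n, B n = univ := by
    refine eq_univ_of_forall fun z => mem_iUnion.2 ?_
    obtain ⟨n, hn⟩ := exists_nat_gt (max (dist z.1 x₀) (dist z.2 x₀))
    exact ⟨n, (le_max_left _ _).trans_lt hn, (le_max_right _ _).trans_lt hn⟩
  have hlim : Tendsto (fun n => π (B n)) atTop (𝓝 1) := by
    have := tendsto_measure_iUnion_atTop (μ := π) hBmono
    rwa [hBU, measure_univ] at this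
  -- Starting from a set of mass above `1/2` keeps every normalising constant at most `2`.
  obtain ⟨N, hN⟩ := eventually_atTop.1 (hlim.eventually_const_lt
    (show (2 : ℝ≥0∞)⁻¹ < 1 by simp))
  let A : ℕ → Set (X × X) := fun n => B (n + N)
  have hAm : ∀ n, MeasurableSet (A n) := fun n => hBm _
  have hAmono : Monotone A := fun n k h => hBmono (by omega)
  have hAU : ⋃ n, A n = univ := by
    rw [← hBU]
    exact hBmono.iUnion_nat_add N
  have hA : ∀ n, 2⁻¹ < π (A n) := fun n => hN _ (by omega)
  have hA0 : ∀ n, π (A n) ≠ 0 := fun n => (zero_le.trans_lt (hA n)).ne'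
  have hAlim : Tendsto (fun n => π (A n)) atTop (𝓝 1) := hlim.comp (tendsto_add_atTop_nat N)
  have hclim : Tendsto (fun n => (π (A n))⁻¹) atTop (𝓝 1) := by
    simpa using tendsto_inv_iff.2 hAlim
  have hp : ∀ n, IsProbabilityMeasure ((π (A n))⁻¹ • π.restrict (A n)) := fun n =>
    ⟨by simp [ENNReal.inv_mul_cancel (hA0 n) (measure_ne_top _ _)]⟩
  have hbound : ∀ n (f : X × X → X), Measurable f →
      (∀ z ∈ A n, f z ∈ Metric.ball x₀ ((n + N : ℕ) : ℝ)) →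
      ((π (A n))⁻¹ • π.restrict (A n)).map f ∈ P2 X := fun n f hf hmem => by
    refine ⟨Measure.isProbabilityMeasure_map hf.aemeasurable, x₀, ?_⟩
    rw [lintegral_map (by fun_prop) hf, lintegral_smul_measure, smul_eq_mul]
    refine ENNReal.mul_lt_top (ENNReal.inv_lt_top.2 (pos_iff_ne_zero.2 (hA0 n))) ?_
    calc ∫⁻ z in A n, edist (f z) x₀ ^ 2 ∂π
        ≤ ∫⁻ _ in A n, ENNReal.ofReal ((n + N : ℕ) : ℝ) ^ 2 ∂π := by
          refine setLIntegral_mono (by fun_prop) fun z hz => ?_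
          gcongr
          rw [edist_dist]
          exact ENNReal.ofReal_le_ofReal (Metric.mem_ball.1 (hmem z hz)).le
      _ < ∞ := by
          rw [setLIntegral_const]
          exact ENNReal.mul_lt_top (ENNReal.pow_lt_top ENNReal.ofReal_lt_top) (measure_lt_top _ _)
  refine ⟨fun n => (π (A n))⁻¹, fun n => (π (A n))⁻¹ • π.restrict (A n), hp, fun n => ?_, hclim,
    fun n => ?_, fun n => ENNReal.inv_ne_zero.2 (measure_ne_top _ _),
    fun n => hbound n _ measurable_fst fun z hz => hz.1,
    fun n => hbound n _ measurable_snd fun z hz => hz.2, fun f hf => ?_⟩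
  · exact Measure.le_iff.2 fun s _ => by
      simp only [Measure.smul_apply, smul_eq_mul]
      gcongr
      exact Measure.restrict_le_self
  · exact ENNReal.inv_le_iff_inv_le.1 (hA n).le
  · simp_rw [integral_smul_measure]
    have h1 := tendsto_setIntegral_of_monotone (f := f) hAm hAmono hf.integrableOn
    rw [hAU, Measure.restrict_univ] at h1
    simpa using ((ENNReal.tendsto_toReal ENNReal.one_ne_top).comp hclim).smul h1

end Truncation

/-- The density of `α` is at most `a ρ`, and `α` does not charge `{ρ = 0}`, so `log (a ρ)` splits
`α`-almost everywhere. For the truncations `a = c n → 1`, so normalising costs only `log (c n) → 0`.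
-/
theorem Ent_le_of_le_smul_withDensity {X : Type*} [MeasurableSpace X] {m α : Measure X}
    [SigmaFinite m] [IsProbabilityMeasure α] {ρ : X → ℝ≥0∞} (hρ : Measurable ρ)
    (hfin : ∀ᵐ x ∂m, ρ x ≠ ∞) {a : ℝ≥0∞} (ha0 : a ≠ 0) (ha : a ≠ ∞)
    (hle : α ≤ a • m.withDensity ρ) (hi : Integrable (fun x => Real.log (ρ x).toReal) α) :
    Ent m α ≤ ((Real.log a.toReal + ∫ x, Real.log (ρ x).toReal ∂α : ℝ) : EReal) := by
  have hd : m.withDensity (fun x => ENNReal.ofReal (a.toReal * (ρ x).toReal))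
      = a • m.withDensity ρ := by
    rw [← withDensity_smul _ hρ]
    refine withDensity_congr_ae ?_
    filter_upwards [hfin] with x hx
    rw [ENNReal.ofReal_mul ENNReal.toReal_nonneg, ENNReal.ofReal_toReal ha,
      ENNReal.ofReal_toReal hx]
    rfl
  have hac : α ≪ m.withDensity ρ :=
    (Measure.absolutelyContinuous_of_le hle).trans (Measure.smul_absolutelyContinuous)
  have hpos : ∀ᵐ x ∂α, 0 < (ρ x).toReal := by
    refine hac.ae_le ((ae_withDensity_iff hρ).2 ?_)
    filter_upwards [hfin] with x hx h0
    exact ENNReal.toReal_pos h0 hx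
  have hlog : (fun x => Real.log (a.toReal * (ρ x).toReal))
      =ᵐ[α] fun x => Real.log a.toReal + Real.log (ρ x).toReal := by
    filter_upwards [hpos] with x hx
    exact Real.log_mul (ENNReal.toReal_pos ha0 ha).ne' hx.ne'
  have hi' : Integrable (fun x => Real.log a.toReal + Real.log (ρ x).toReal) α :=
    (integrable_const _).add hi
  have h := Ent_le_of_le_withDensity (v := fun x => a.toReal * (ρ x).toReal)
    (fun x => mul_nonneg ENNReal.toReal_nonneg ENNReal.toReal_nonneg) (by rw [hd]; exact hle)
    (hi'.congr hlog.symm)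
  rwa [integral_congr_ae hlog, integral_add (integrable_const _) hi, integral_const,
    probReal_univ, one_smul] at h

theorem MetricFoliation.map_proj_bind {X : Type*} [MetricSpace X] [MeasurableSpace X]
    [BorelSpace X] {F : MetricFoliation X} {m : Measure X} {κ : Kernel F.LeafSpace X}
    (hκ : F.IsDisintegration m κ) {ν : Measure F.LeafSpace} (hac : ν ≪ F.quotientMeasure m) :
    (κ ∘ₘ ν).map F.proj = ν := by
  have hp : Measurable F.proj := F.continuous_proj.measurable
  ext s hs
  rw [Measure.map_apply hp hs, Measure.bind_apply (hp hs) (Kernel.aemeasurable _),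
    ← lintegral_indicator_one hs]
  refine lintegral_congr_ae ?_
  filter_upwards [hac.ae_le hκ.concentrated] with y hy
  have := hκ.isProbabilityMeasure y
  by_cases hys : y ∈ s
  · rw [indicator_of_mem hys, Pi.one_apply, ← prob_compl_eq_zero_iff (hp hs)]
    refine measure_mono_null (compl_subset_compl.2 ?_) hy
    exact preimage_mono (singleton_subset_iff.2 hys)
  · rw [indicator_of_notMem hys]
    refine measure_mono_null ?_ hy
    intro x hx hxy
    exact hys ((show F.proj x = y from hxy) ▸ hx)

/-! ### Descent of the curvature-dimension condition -/

theorem map_mem_P2 {X Y : Type*} [MetricSpace X] [MeasurableSpace X] [BorelSpace X]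
    [SecondCountableTopology X] [MetricSpace Y] [MeasurableSpace Y] [BorelSpace Y]
    [SecondCountableTopology Y] {f : X → Y} (hf : LipschitzWith 1 f) {μ : Measure X}
    (hμ : μ ∈ P2 X) : μ.map f ∈ P2 Y := by
  obtain ⟨hp, x₀, h⟩ := hμ
  have hfm : Measurable f := hf.continuous.measurable
  refine ⟨Measure.isProbabilityMeasure_map hfm.aemeasurable, f x₀, ?_⟩
  rw [lintegral_map (by fun_prop) hfm]
  refine (lintegral_mono fun x => ?_).trans_lt h
  have := hf x x₀
  rw [ENNReal.coe_one, one_mul] at this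
  gcongr

theorem integrable_exp_add {Y : Type*} [MeasurableSpace Y] {m : Measure Y} {b h : Y → ℝ}
    (hb : Measurable b) {M : ℝ} (hM : ∀ y, |b y| ≤ M) (hm : Measurable h)
    (he : Integrable (fun y => Real.exp (h y)) m) :
    Integrable (fun y => Real.exp (b y + h y)) m := by
  refine (he.const_mul (Real.exp M)).mono'
    (Real.measurable_exp.comp (hb.add hm)).aestronglyMeasurable (Eventually.of_forall fun y => ?_)
  rw [Real.norm_of_nonneg (Real.exp_pos _).le, Real.exp_add]
  gcongr
  exact (le_abs_self _).trans (hM y)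

theorem EReal.convexBound_le {t K W a b : ℝ} (ht : t ∈ Icc (0 : ℝ) 1) {x y : EReal} (hx : x ≤ a)
    (hy : y ≤ b) :
    ((1 - t : ℝ) : EReal) * x + (t : EReal) * y - ((K / 2 * t * (1 - t) * W : ℝ) : EReal)
      ≤ (((1 - t) * a + t * b - K / 2 * t * (1 - t) * W : ℝ) : EReal) := by
  have h1 : (0 : EReal) ≤ ((1 - t : ℝ) : EReal) := by
    exact_mod_cast _root_.sub_nonneg.2 ht.2
  have h2 : (0 : EReal) ≤ ((t : ℝ) : EReal) := by exact_mod_cast ht.1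
  calc _ ≤ ((1 - t : ℝ) : EReal) * a + (t : EReal) * b
        - ((K / 2 * t * (1 - t) * W : ℝ) : EReal) :=
        EReal.sub_le_sub (add_le_add (mul_le_mul_of_nonneg_left hx h1)
          (mul_le_mul_of_nonneg_left hy h2)) le_rfl
    _ = _ := by norm_cast

theorem theorem3p14 {X : Type*} [MetricSpace X] [MeasurableSpace X] (m : Measure X)
    (hX : IsMMSpace X m) (F : MetricFoliation X) (hF : F.IsMetricMeasureFoliation m) (K : ℝ)
    (hCD : CDInfty K m) (hVG : VolumeGrowth (F.quotientMeasure m)) :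
    CDInfty K (F.quotientMeasure m) := by
  have := hX.complete
  have := hX.separable
  have := hX.borel
  have : SecondCountableTopology X := UniformSpace.secondCountable_of_separable X
  have : SecondCountableTopology F.LeafSpace := UniformSpace.secondCountable_of_separable _
  obtain ⟨hfin, κ, hκ, Ω, hΩm, hΩ, hW⟩ := hF
  have : IsMarkovKernel κ := ⟨hκ.isProbabilityMeasure⟩
  obtain ⟨o, C, -, hC⟩ := hVG
  have hp : Measurable F.proj := F.continuous_proj.measurable
  obtain ⟨x₀, hx₀⟩ := F.proj_surjective o
  have : Nonempty X := ⟨x₀⟩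
  have : Nonempty F.LeafSpace := ⟨o⟩
  have : SigmaFinite m := hX.finiteOnBalls.sigmaFinite
  have hσ : SigmaFinite (F.quotientMeasure m) := hfin.sigmaFinite
  have he : Integrable (fun y => Real.exp (-(C ^ 2 * dist y o ^ 2))) (F.quotientMeasure m) := by
    refine ⟨by fun_prop, lt_of_le_of_lt (lintegral_mono fun y => ?_) hC⟩
    rw [Real.enorm_eq_ofReal (Real.exp_pos _).le]
  have hhm : Measurable fun y : F.LeafSpace => -(C ^ 2 * dist y o ^ 2) := by fun_prop
  intro ν₀ h₀ ν₁ h₁ hE₀ hE₁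
  have := h₀.1
  have := h₁.1
  have hhi : ∀ {ν : Measure F.LeafSpace}, ν ∈ P2 F.LeafSpace →
      Integrable (fun y => -(C ^ 2 * dist y o ^ 2)) ν := fun hν =>
    ((integrable_dist_sq (lintegral_edist_sq_lt_top hν o)).const_mul _).neg
  -- lift of the end points and of an optimal plan
  have hlift : ∀ {ν : Measure F.LeafSpace},
      ν ≪ F.quotientMeasure m → ∀ᵐ y ∂ν, y ∈ Ω := fun hac => hac.ae_le (mem_ae_iff.2 hΩ)
  have hac₀ := absolutelyContinuous_of_Ent_lt_top hE₀
  have hac₁ := absolutelyContinuous_of_Ent_lt_top hE₁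
  obtain ⟨π, hπ, hcost⟩ := exists_plan_bind_le (fun y hy y' hy' => (hW y hy y' hy').le) h₀ h₁
    (hlift hac₀) (hlift hac₁)
  have := isProbabilityMeasure_of_mem_transportPlans hπ
  -- The plan is truncated rather than its marginals, so that the restricted plan remains a
  -- competitor for the distance between the new end points.
  obtain ⟨c, π', hpπ, hle, hc1, hc2, hc0, hP2₀, hP2₁, hconv⟩ := exists_truncation π x₀
  have hcfin : ∀ n, c n ≠ ∞ := fun n => ne_top_of_le_ne_top (by simp) (hc2 n)
  -- behaviour of one end point
  have hend : ∀ (ν : Measure F.LeafSpace) (_ : IsProbabilityMeasure ν) (f : X × X → X),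
      Measurable f → π.map f = κ ∘ₘ ν → ν ∈ P2 F.LeafSpace →
      Ent (F.quotientMeasure m) ν < ⊤ →
      ∃ (e : ℕ → ℝ) (E : ℝ), Tendsto e atTop (𝓝 E) ∧ Ent (F.quotientMeasure m) ν = E ∧
        (∀ n, Ent m ((π' n).map f) ≤ e n) ∧
        (∀ n, ((π' n).map f).map F.proj ≤ (2 : ℝ≥0∞) • ν) ∧
        ∀ g : BoundedContinuousFunction F.LeafSpace ℝ,
          Tendsto (fun n => ∫ y, g y ∂((π' n).map f).map F.proj) atTop (𝓝 (∫ y, g y ∂ν)) := by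
    intro ν _ f hf hmap hν hE
    have hac := absolutelyContinuous_of_Ent_lt_top hE
    have hνmap : π.map (fun z => F.proj (f z)) = ν := by
      rw [← MetricFoliation.map_proj_bind hκ hac, ← hmap, Measure.map_map hp hf]; rfl
    have hpf : Measurable fun z => F.proj (f z) := hp.comp hf
    have hmono : ∀ n, (π' n).map f ≤ c n • (κ ∘ₘ ν) := fun n => by
      rw [← hmap, ← Measure.map_smul]
      exact Measure.map_mono (hle n) hf
    have hcomp : ∀ g : F.LeafSpace → ℝ, Measurable g → Integrable g ν →
        Tendsto (fun n => ∫ z, g (F.proj (f z)) ∂π' n) atTop (𝓝 (∫ y, g y ∂ν)) := by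
      intro g hg hgi
      have hgi' : Integrable (fun z => g (F.proj (f z))) π := by
        rw [← hνmap] at hgi
        exact hgi.comp_measurable hpf
      have := hconv _ hgi'
      rwa [← integral_map (φ := fun z => F.proj (f z)) hpf.aemeasurable
        hg.aestronglyMeasurable, hνmap] at this
    have hlogm : Measurable fun y => Real.log (ν.rnDeriv (F.quotientMeasure m) y).toReal :=
      Real.measurable_log.comp (ν.measurable_rnDeriv _).ennreal_toReal
    -- By (VG) the entropy of `ν` is finite with integrable logarithmic density; the integrals over
    -- the truncated plans then converge to it.
    have hlogi := integrable_log_rnDeriv hE (hhi hν) he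
    have hlogπ : ∀ n, Integrable
        (fun x => Real.log (ν.rnDeriv (F.quotientMeasure m) (F.proj x)).toReal)
        ((π' n).map f) := fun n => by
      refine Integrable.mono_measure (ν := c n • (κ ∘ₘ ν)) ?_ (hmono n)
      refine Integrable.smul_measure ?_ (hcfin n)
      have h1 : Integrable (fun y => Real.log (ν.rnDeriv (F.quotientMeasure m) y).toReal)
          ((κ ∘ₘ ν).map F.proj) := by rwa [MetricFoliation.map_proj_bind hκ hac]
      exact h1.comp_measurable hp
    refine ⟨fun n => Real.log (c n).toReal
      + ∫ z, Real.log (ν.rnDeriv (F.quotientMeasure m) (F.proj (f z))).toReal ∂π' n,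
      ∫ y, Real.log (ν.rnDeriv (F.quotientMeasure m) y).toReal ∂ν, ?_,
      Ent_eq_integral_log hE (hhi hν) he, fun n => ?_, fun n => ?_, fun g => ?_⟩
    · have h1 : Tendsto (fun n => Real.log (c n).toReal) atTop (𝓝 0) := by
        have h2 := (ENNReal.tendsto_toReal ENNReal.one_ne_top).comp hc1
        rw [ENNReal.toReal_one] at h2
        have h3 := (Real.continuousAt_log one_ne_zero).tendsto.comp h2
        rwa [Real.log_one] at h3
      simpa using h1.add (hcomp _ hlogm hlogi)
    · have := Measure.isProbabilityMeasure_map (μ := π' n) hf.aemeasurable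
      have hb := MetricFoliation.bind_eq_withDensity hκ hac
      have h1 := Ent_le_of_le_smul_withDensity (m := m) (α := (π' n).map f)
        (ρ := fun x => ν.rnDeriv (F.quotientMeasure m) (F.proj x))
        ((ν.measurable_rnDeriv _).comp hp)
        (ae_of_ae_map hp.aemeasurable (ν.rnDeriv_ne_top (F.quotientMeasure m)))
        (hc0 n) (hcfin n) (by rw [← hb]; exact hmono n) (hlogπ n)
      have h2 : Measurable fun x =>
          Real.log (ν.rnDeriv (F.quotientMeasure m) (F.proj x)).toReal := hlogm.comp hp
      rwa [integral_map hf.aemeasurable h2.aestronglyMeasurable] at h1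
    · rw [← MetricFoliation.map_proj_bind hκ hac, ← Measure.map_smul]
      refine Measure.map_mono ((hmono n).trans ?_) hp
      exact Measure.le_iff.2 fun s _ => by
        simp only [Measure.smul_apply, smul_eq_mul]
        gcongr
        exact hc2 n
    · have h1 := hcomp g g.continuous.measurable (g.integrable ν)
      have h2 : ∀ n, ∫ y, g y ∂((π' n).map f).map F.proj = ∫ z, g (F.proj (f z)) ∂π' n :=
        fun n => by
          rw [Measure.map_map hp hf,
            integral_map (hp.comp hf).aemeasurable g.continuous.measurable.aestronglyMeasurable]
          rfl
      simpa only [h2] using h1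
  obtain ⟨e₀, E₀, he₀, hEq₀, hEn₀, hdom₀, hlim₀⟩ :=
    hend ν₀ inferInstance Prod.fst measurable_fst hπ.1 h₀ hE₀
  obtain ⟨e₁, E₁, he₁, hEq₁, hEn₁, hdom₁, hlim₁⟩ :=
    hend ν₁ inferInstance Prod.snd measurable_snd hπ.2 h₁ hE₁
  -- geodesics between the truncated measures
  choose μ hμ hμ0 hμ1 hμE using fun n => hCD _ (hP2₀ n) _ (hP2₁ n)
    ((hEn₀ n).trans_lt (EReal.coe_lt_top _)) ((hEn₁ n).trans_lt (EReal.coe_lt_top _))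
  -- The parameter is projected to `[0, 1]` because nothing is known about `μ n t` at other real
  -- `t`, while probability measures are wanted for every `t`.
  let ν : ℕ → ℝ → Measure F.LeafSpace := fun n t =>
    (μ n (projIcc 0 1 zero_le_one t)).map F.proj
  have hνI : ∀ n, ∀ t ∈ Icc (0 : ℝ) 1, ν n t = (μ n t).map F.proj := fun n t ht => by
    simp only [ν, projIcc_of_mem zero_le_one ht]
  have hνP2 : ∀ n t, ν n t ∈ P2 F.LeafSpace := fun n t =>
    map_mem_P2 F.lipschitzWith_proj ((hμ n).1 _ (projIcc 0 1 zero_le_one t).2)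
  have hνp : ∀ n t, IsProbabilityMeasure (ν n t) := fun n t => (hνP2 n t).1
  have hν0 : ∀ n, ν n 0 = ((π' n).map Prod.fst).map F.proj := fun n => by
    rw [hνI n 0 ⟨le_rfl, zero_le_one⟩, hμ0]
  have hν1 : ∀ n, ν n 1 = ((π' n).map Prod.snd).map F.proj := fun n => by
    rw [hνI n 1 ⟨zero_le_one, le_rfl⟩, hμ1]
  let δ : ℕ → ℝ≥0∞ := fun n => W2 ((π' n).map Prod.fst) ((π' n).map Prod.snd) ^ 2
  have hδ : ∀ n, δ n ≤ c n * W2 ν₀ ν₁ ^ 2 := fun n => by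
    refine (W2_sq_le ⟨rfl, rfl⟩).trans ?_
    calc transportCost (π' n) ≤ ∫⁻ z, edist z.1 z.2 ^ 2 ∂(c n • π) :=
          lintegral_mono' (hle n) le_rfl
      _ = c n * transportCost π := by rw [lintegral_smul_measure]; rfl
      _ ≤ _ := by gcongr
  have hWfin : W2 ν₀ ν₁ ^ 2 ≠ ∞ := ENNReal.pow_ne_top (W2_lt_top h₀ h₁).ne
  have hD : Tendsto (fun n => c n * W2 ν₀ ν₁ ^ 2) atTop (𝓝 (W2 ν₀ ν₁ ^ 2)) := by
    simpa using ENNReal.Tendsto.mul_const hc1 (Or.inr hWfin)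
  obtain ⟨γ, hγ, hγ0, hγ1, hγE⟩ := exists_isW2Geodesic_of_approx (K := K) he h₀ h₁ (ν := ν)
    (by simpa only [hν0] using hdom₀) (by simpa only [hν1] using hdom₁)
    (by simpa only [hν0] using hlim₀) (by simpa only [hν1] using hlim₁) hD
    (fun n => by gcongr; exact hc2 n) hδ
    (fun n s hs t ht => by
      rw [hνI n s hs, hνI n t ht]
      calc W2 ((μ n s).map F.proj) ((μ n t).map F.proj) ^ 2 ≤ W2 (μ n s) (μ n t) ^ 2 := by
            gcongr
            exact W2_map_le F.lipschitzWith_proj _ _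
        _ = _ := by rw [(hμ n).2 s hs t ht, hμ0, hμ1, mul_pow])
    he₀ he₁ (by
      rintro n t ht b hb ⟨M, hM⟩
      have htI : t ∈ Icc (0 : ℝ) 1 := ⟨ht.1.le, ht.2.le⟩
      have hup := (hμE n t htI).trans (EReal.convexBound_le htI (hEn₀ n) (hEn₁ n))
      have := ((hμ n).1 t htI).1
      have hνi := hhi (hνP2 n t)
      have hbi : Integrable b (ν n t) :=
        Integrable.of_bound hb.aestronglyMeasurable M (Eventually.of_forall hM)
      have hsum : Integrable (fun y => b y + -(C ^ 2 * dist y o ^ 2)) (ν n t) := hbi.add hνi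
      have hexp := integrable_exp_add hb hM hhm he
      rw [← integral_add hbi hνi]
      rw [hνI n t htI] at hsum ⊢
      have hGm : Measurable fun y => b y + -(C ^ 2 * dist y o ^ 2) := hb.add hhm
      have hEm : Measurable fun y => Real.exp (b y + -(C ^ 2 * dist y o ^ 2)) :=
        Real.measurable_exp.comp hGm
      -- The dual bound on `X` is tested only with functions constant on the leaves. Their
      -- exponentials are `m`-integrable by (VG) on the quotient, so no growth condition on `X` is
      -- needed.
      have key := integral_add_one_sub_le_of_Ent_le hup (hsum.comp_measurable hp)
        (hexp.comp_measurable hp)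
      rw [integral_map hp.aemeasurable hGm.aestronglyMeasurable, MetricFoliation.quotientMeasure,
        integral_map hp.aemeasurable hEm.aestronglyMeasurable]
      rw [← ENNReal.toReal_pow] at key
      exact key)
  refine ⟨γ, hγ, hγ0, hγ1, fun t ht => ?_⟩
  have hcoe : ((1 - t : ℝ) : EReal) * Ent (F.quotientMeasure m) ν₀
      + (t : EReal) * Ent (F.quotientMeasure m) ν₁
        - ((K / 2 * t * (1 - t) * (W2 ν₀ ν₁).toReal ^ 2 : ℝ) : EReal)
      = (((1 - t) * E₀ + t * E₁ - K / 2 * t * (1 - t) * (W2 ν₀ ν₁).toReal ^ 2 : ℝ) : EReal) := by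
    rw [hEq₀, hEq₁]
    norm_cast
  rw [hcoe]
  rcases eq_or_ne t 0 with rfl | ht0
  · rw [hγ0, hEq₀]
    simp
  rcases eq_or_ne t 1 with rfl | ht1
  · rw [hγ1, hEq₁]
    simp
  exact hγE t ⟨lt_of_le_of_ne ht.1 ht0.symm, lt_of_le_of_ne ht.2 ht1⟩
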